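/- **Conventions.** A $k\times\ell$ *partial permutation* is a $0$–$1$ matrix $w$ of size $k\times\ell$ with at most one $1$ in each row and each column; we write $w(p)=q$ if its entry at $(p,q)$ is $1$. Let $S_\infty$ be the group of permutations of $\{1,2,\dots\}$ that fix all but finitely many points, $l(v)$ the number of inversions of $v\in S_\infty$, and $s_i\in S_\infty$ the transposition of $i$ and $i+1$. A permutation $v$ is identified with its matrix, with $1$ at the positions $(p,v(p))$. Every partial permutation $w$ has a unique completion $\widetilde w\in S_\infty$ of minimal length having $w$ as its upper-left $k\times\ell$ corner. For $m\in\mathbb N$, $m+w$ is the $(m+k)\times(m+\ell)$ partial permutation with an identity block in the first $m$ rows and columns and $w$ in the last $k$ rows and $\ell$ columns (and zeros elsewhere). A $k\times\ell$ *pipe dream* is a subset $P$ (its *crosses*) of the $k\times\ell$ grid. Its *Demazure product* $\delta(P)\in S_\infty$ is obtained by reading the crosses of $P$ along rows from right to left, from the top row downward; starting from the identity, the cross in row $p$ and column $q$ replaces the current permutation $v$ by $vs_{p+q-1}$ if this increases the length, and is omitted otherwise. Let $\check P$ be $P$ rotated by $180^\circ$, and $\mathcal P(w)$ the set of $k\times\ell$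 pipe dreams $P$ with $\delta(P)=\widetilde w$. Let $r_0,\dots,r_n$ be nonnegative integers with sum $d$. Divide the $d\times d$ grid into blocks $B_{ji}$ ($0\le i,j\le n$), where block row $j$, counted from the top, has height $r_j$ and block column $i$, counted *from the right*, has width $r_i$. A permutation $v\in S_d$ is a *Zelevinsky permutation* if $B_{ji}$ is zero whenever $i\ge j+2$ and the $1$'s in every block row and in every block column proceed from northwest to southeast. Its *rank array* is $(r_{ij})_{0\le i\le j\le n}$, where $r_{ij}$ is the number of $1$'s of $v$ in the blocks $B_{qp}$ with $q\ge j$ and $p\le i$; in particular $r_{jj}=r_j$. The rank array determines $v$, and we write $v=v(\mathbf r)$. A *lacing diagram* with ranks $r_0,\dots,r_n$ is a list $\mathbf w=(w_1,\dots,w_n)$ in which $w_j$ is an $r_{j-1}\times r_j$ partial permutation. For pipe dreams $P_j$ of size $r_{j-1}\times r_j$ ($1\le j\le n$), let $P(P_1,\dots,P_n)$ be the $d\times d$ pipe dream in which all blocks $B_{ji}$ with $i\ge j+2$ are filled with crosses, the block $B_{j-1,j}$ is $P_j$ for each $j$, and there are no other crosses. We write $\delta(\mathbf w)=\mathbf r$,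 and call $\mathbf r$ the *Demazure product* of $\mathbf w$, if for some (equivalently, every) choice of $P_1,\dots,P_n$ with $\check P_j\in\mathcal P(w_j)$ for all $j$ the permutation $\delta(P(P_1,\dots,P_n))$ equals the Zelevinsky permutation $v(\mathbf r)$. Let $L(\mathbf r)$ be the set of lacing diagrams $\mathbf w$ with $\delta(\mathbf w)=\mathbf r$. For $m\in\mathbb N$, let $m+\mathbf r$ be the array obtained by adding $m$ to each entry of $\mathbf r$, and set $m+\mathbf w=(m+w_1,\dots,m+w_n)$. **Proposition.** For every array $\mathbf r=(r_{ij})_{0\le i\le j\le n}$ of nonnegative integers and every $m\in\mathbb N$, $$L(m+\mathbf r)=\{\,m+\mathbf w \mid \mathbf w\in L(\mathbf r)\,\},$$ and $\mathbf w\mapsto m+\mathbf w$ is a bijection from $L(\mathbf r)$ onto $L(m+\mathbf r)$. -/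

import Mathlib

/-!
Conventions.  Rows, columns, permutations and simple reflections are numbered from `0`.
Thus a permutation of `{1, 2, 3, …}` becomes a permutation of `ℕ`, and the simple reflection
`s_{i+1}` becomes the transposition of `i` and `i + 1`.
-/

namespace LacingDiagrams

/-! ### Permutations and Demazure products -/

/-- Membership in `S_∞`: all but finitely many points are fixed. -/
def FinitelySupported (v : Equiv.Perm ℕ) : Prop :=
  {x | v x ≠ x}.Finite

/-- The length of a permutation: its number of inversions. -/
noncomputable def length (v : Equiv.Perm ℕ) : ℕ :=
  {p : ℕ × ℕ | p.1 < p.2 ∧ v p.2 < v p.1}.ncard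

/-- The transposition exchanging `i` and `i + 1`. -/
def simpleReflection (i : ℕ) : Equiv.Perm ℕ :=
  Equiv.swap i (i + 1)

open Classical in
/-- Multiplication by a simple reflection on the right, where a reflection that would decrease
the length is omitted. -/
noncomputable def demazureMul (v : Equiv.Perm ℕ) (i : ℕ) : Equiv.Perm ℕ :=
  if length v < length (v * simpleReflection i) then v * simpleReflection i else v

/-- The Demazure product of a word in the simple reflections. -/
noncomputable def wordDemazure (Q : List ℕ) : Equiv.Perm ℕ :=
  Q.foldl demazureMul 1

/-! ### Partial permutations -/

/-- A `k × l` partial permutation: `w p = some q` means that the entry in row `p` and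
column `q` is `1`. -/
abbrev PartialPerm (k l : ℕ) : Type := Fin k ≃. Fin l

/-- The permutation `v` of `S_∞` has `w` as its upper-left `k × l` corner. -/
def Completes {k l : ℕ} (w : PartialPerm k l) (v : Equiv.Perm ℕ) : Prop :=
  FinitelySupported v ∧ ∀ (p : Fin k) (q : Fin l), v (p : ℕ) = (q : ℕ) ↔ w p = some q

/-- `v` is the completion of `w` of minimal length. -/
def IsMinimalCompletion {k l : ℕ} (w : PartialPerm k l) (v : Equiv.Perm ℕ) : Prop :=
  Completes w v ∧ ∀ u : Equiv.Perm ℕ, Completes w u → length v ≤ length u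

/-- The partial permutation `m + w`: it fixes the first `m` indices, and acts as `w` on the
indices that come after them. -/
def shiftPartialPerm (m : ℕ) {k l : ℕ} (w : PartialPerm k l) :
    PartialPerm (m + k) (m + l) where
  toFun := Fin.addCases (fun i => some (Fin.castAdd l i)) (fun p => (w p).map (Fin.natAdd m))
  invFun :=
    Fin.addCases (fun i => some (Fin.castAdd k i)) (fun q => (w.symm q).map (Fin.natAdd m))
  inv := by
    intro a b
    induction a using Fin.addCases with
    | left i =>
      induction b using Fin.addCases with
      | left j => simp [eq_comm]
      | right q => simp [Fin.ext_iff]; omega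
    | right p =>
      induction b using Fin.addCases with
      | left j => simp [Fin.ext_iff]; omega
      | right q =>
        simp only [Fin.addCases_right, Option.map_eq_some_iff,
          Fin.natAdd_inj, exists_eq_right]
        exact w.inv p q

/-! ### Pipe dreams -/

/-- A `k × l` pipe dream, given by its set of crosses. -/
abbrev PipeDream (k l : ℕ) : Type := Finset (Fin k × Fin l)

/-- The word of a pipe dream: the antidiagonal indices of the crosses, read along the rows
from right to left, starting with the top row and proceeding downward. -/
def PipeDream.word {k l : ℕ} (P : PipeDream k l) : List ℕ :=
  (List.finRange k).flatMap fun p =>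
    ((List.finRange l).reverse.filter fun q => (p, q) ∈ P).map fun q => (p : ℕ) + (q : ℕ)

/-- The Demazure product of a pipe dream. -/
noncomputable def PipeDream.demazure {k l : ℕ} (P : PipeDream k l) : Equiv.Perm ℕ :=
  wordDemazure (PipeDream.word P)

/-- The pipe dream rotated through 180 degrees. -/
def PipeDream.rotate {k l : ℕ} (P : PipeDream k l) : PipeDream k l :=
  Finset.univ.filter fun x => (x.1.rev, x.2.rev) ∈ P

/-- The set of pipe dreams (reduced or not) for the partial permutation `w`: those whose
Demazure product is the minimal completion of `w`. -/
def pipeDreams {k l : ℕ} (w : PartialPerm k l) : Set (PipeDream k l) :=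
  {P | IsMinimalCompletion w (PipeDream.demazure P)}

/-! ### Block decompositions and Zelevinsky permutations

For `b = (b 0, …, b n)` with sum `d`, the `d × d` grid is divided into blocks.  Block row `j`,
counted from the top, has height `b j`, and block column `i`, counted from the right, has
width `b i`. -/

section Blocks

variable {n : ℕ}

/-- The first row of block row `j`. -/
def rowStart (b : Fin (n + 1) → ℕ) (j : Fin (n + 1)) : ℕ :=
  ∑ i ∈ Finset.univ.filter (fun i => i < j), b i

/-- The first column of block column `i`. -/
def colStart (b : Fin (n + 1) → ℕ) (i : Fin (n + 1)) : ℕ :=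
  ∑ j ∈ Finset.univ.filter (fun j => i < j), b j

/-- Row `x` lies in block row `j`. -/
def InBlockRow (b : Fin (n + 1) → ℕ) (j : Fin (n + 1)) (x : ℕ) : Prop :=
  rowStart b j ≤ x ∧ x < rowStart b j + b j

/-- Column `y` lies in block column `i`. -/
def InBlockCol (b : Fin (n + 1) → ℕ) (i : Fin (n + 1)) (y : ℕ) : Prop :=
  colStart b i ≤ y ∧ y < colStart b i + b i

/-- `v` is a Zelevinsky permutation for the block sizes `b`: it is a permutation of the
`d = ∑ j, b j` indices of the grid (extended by the identity), it has no nonzero entry in the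
block in block row `j` and block column `i` if `i ≥ j + 2`, and within every block row and
every block column its nonzero entries proceed from northwest to southeast. -/
structure IsZelevinsky (b : Fin (n + 1) → ℕ) (v : Equiv.Perm ℕ) : Prop where
  fixes : ∀ x, ∑ j, b j ≤ x → v x = x
  zeroBlocks : ∀ (i j : Fin (n + 1)) (x : ℕ),
    InBlockRow b j x → InBlockCol b i (v x) → ¬ (j : ℕ) + 2 ≤ (i : ℕ)
  blockRows : ∀ (j : Fin (n + 1)) (x x' : ℕ),
    InBlockRow b j x → InBlockRow b j x' → x < x' → v x < v x'
  blockCols : ∀ (i : Fin (n + 1)) (x x' : ℕ),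
    InBlockCol b i (v x) → InBlockCol b i (v x') → x < x' → v x < v x'

/-- The number of nonzero entries of `v` in the blocks weakly southeast of the one in block
row `j` and block column `i`. -/
noncomputable def southeastRank (b : Fin (n + 1) → ℕ) (v : Equiv.Perm ℕ)
    (i j : Fin (n + 1)) : ℕ :=
  {x : ℕ | ∃ q p : Fin (n + 1), j ≤ q ∧ p ≤ i ∧ InBlockRow b q x ∧ InBlockCol b p (v x)}.ncard

/-- The pipe dream `P(P_1, …, P_n)`: every block strictly above the block superantidiagonal is
filled with crosses, the superantidiagonal blocks are the given pipe dreams, and there are no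
other crosses.  (Here `Ps j` is `P_{j+1}`; it lies in block row `j` and block column `j + 1`.) -/
noncomputable def assemble (b : Fin (n + 1) → ℕ)
    (Ps : ∀ j : Fin n, PipeDream (b j.castSucc) (b j.succ)) :
    PipeDream (∑ j, b j) (∑ j, b j) := by
  classical
  exact Finset.univ.filter fun x =>
    (∃ i j : Fin (n + 1), (j : ℕ) + 2 ≤ (i : ℕ) ∧ InBlockRow b j x.1 ∧ InBlockCol b i x.2) ∨
    (∃ (j : Fin n) (p : Fin (b j.castSucc)) (q : Fin (b j.succ)), (p, q) ∈ Ps j ∧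
      (x.1 : ℕ) = rowStart b j.castSucc + p ∧ (x.2 : ℕ) = colStart b j.succ + q)

end Blocks

/-! ### Lacing diagrams and their Demazure products -/

/-- Arrays `r = (r_{ij})` of natural numbers indexed by `0 ≤ i ≤ j ≤ n`. -/
abbrev TriArray (n : ℕ) : Type :=
  {p : Fin (n + 1) × Fin (n + 1) // p.1 ≤ p.2} → ℕ

/-- The ranks `r_j = r_{jj}`. -/
abbrev TriArray.ranks {n : ℕ} (r : TriArray n) : Fin (n + 1) → ℕ :=
  fun j => r ⟨(j, j), le_rfl⟩

/-- The array `m + r`: add `m` to every entry. -/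
abbrev TriArray.shift (m : ℕ) {n : ℕ} (r : TriArray n) : TriArray n :=
  fun p => m + r p

/-- A lacing diagram with `b j` dots in column `j`: a list `(w_1, …, w_n)` of partial
permutations, where `w_j` has size `b (j-1) × b j`.  (The component at `j : Fin n` is
`w_{j+1}`.) -/
abbrev LacingDiagram {n : ℕ} (b : Fin (n + 1) → ℕ) : Type :=
  ∀ j : Fin n, PartialPerm (b j.castSucc) (b j.succ)

/-- The lacing diagram `m + w = (m + w_1, …, m + w_n)`. -/
def LacingDiagram.shift (m : ℕ) {n : ℕ} {b : Fin (n + 1) → ℕ} (w : LacingDiagram b) :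
    LacingDiagram (fun j => m + b j) :=
  fun j => shiftPartialPerm m (w j)

/-- `v` is the Zelevinsky permutation `v(r)`: it is a Zelevinsky permutation for the block sizes
`r_0, …, r_n`, and `r` is its rank array. -/
def IsZelevinskyOf {n : ℕ} (r : TriArray n) (v : Equiv.Perm ℕ) : Prop :=
  IsZelevinsky r.ranks v ∧
    ∀ (i j : Fin (n + 1)) (h : i ≤ j), southeastRank r.ranks v i j = r ⟨(i, j), h⟩

/-- `δ(w) = r`: for some sequence `P_1, …, P_n` of pipe dreams whose 180 degree rotations are
pipe dreams for `w_1, …, w_n`, the Demazure product of `P(P_1, …, P_n)` is the Zelevinsky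
permutation `v(r)`. -/
def HasDemazureProduct {n : ℕ} (r : TriArray n) (w : LacingDiagram r.ranks) : Prop :=
  ∃ Ps : ∀ j : Fin n, PipeDream (r.ranks j.castSucc) (r.ranks j.succ),
    (∀ j, PipeDream.rotate (Ps j) ∈ pipeDreams (w j)) ∧
      IsZelevinskyOf r (PipeDream.demazure (assemble r.ranks Ps))

/-- The set `L(r)` of lacing diagrams with Demazure product `r`. -/
def L {n : ℕ} (r : TriArray n) : Set (LacingDiagram r.ranks) :=
  {w | HasDemazureProduct r w}

end LacingDiagrams

/-!
The Demazure product of a word acts on one-line notations as a sorting process: a letter `i`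
exchanges the entries in positions `i` and `i + 1` if they are increasing.  The word of a
`d × d` pipe dream is read row by row, and after row `x` has been read the entry in position `x`
does not change any more, so it can be split off.

For the pipe dream `P(P_1, …, P_n)` this has a simple description.  Let `c_j` be the first column
of block column `j`.  When block row `j` is reached, the sequence that is left consists of
`0, …, c_j - 1`, in this order, followed by a sequence `E`.  The crosses to the left of the
superantidiagonal just carry the first entry after `0, …, c_{j+1} - 1` to the front.  Hence block
row `j` prepends the columns of block column `j + 1` to `E`, lets `P_{j+1}` sort the result, and
splits off its first `r_j` entries (`assemble_blockRow`).  Here `P_{j+1}` matters only through its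
Demazure product (`sortWord_congr`), because the rank function of a Demazure product is the
min-plus product of the rank functions of the factors (`rankFn_sortWord`).

Now enlarge all blocks by `m` and replace each `δ(P_j)` by `1_m ⊕ δ(P_j)`.  The first `m` of the
columns that are prepended are not touched by `P_{j+1}`, they are split off in the first `m` rows,
and everything else happens as before (`isEnlargement_demazure`).  So the new Demazure product `v'`
is obtained from the old one, `v`, by inserting `m` ones at the northwest corner of every
superantidiagonal block, while the first `m` fixed points after the old grid become part of the
southeast corner block.  It follows that `v'` is the Zelevinsky permutation of `m + r` if and only
if `v` is that of `r` (`IsEnlargement.isZelevinskyOf_iff`).  Together with the existence of pipe dreams for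
all partial permutations (`exists_demazure_eq`), this shows that `m + w` is in `L(m + r)` if and
only if `w` is in `L(r)` (`shift_mem_L_iff`).

Finally, every element of `L(m + r)` is of the form `m + w`: the southeast corner block of
`v(m + r)` contains at least `m` ones, which forces `v(m + r)` to fix the last `m` of the
`d' = d + (n + 1) m` indices.  Hence the letters `s_i` with `i + 1 ≥ d' - m` do not occur in
the word, so the rotated pipe dreams have only letters `≥ m`, and their Demazure products fix `0, …, m - 1`
(`exists_eq_shift_of_mem_L`).
-/

namespace LacingDiagrams

/-! ### Demazure products as sorting processes -/

/-- One sorting move on a sequence `T`: the entries in positions `i` and `i + 1` are exchanged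
if they are in increasing order.  On the one-line notation of a permutation this is Demazure
multiplication by a simple reflection on the right. -/
def sortStep (T : ℕ → ℕ) (i : ℕ) : ℕ → ℕ :=
  if T i < T (i + 1) then T ∘ Equiv.swap i (i + 1) else T

/-- The result of performing the sorting moves of the word `Q`, in order, on the sequence `T`. -/
def sortWord (T : ℕ → ℕ) (Q : List ℕ) : ℕ → ℕ :=
  Q.foldl sortStep T

@[simp] lemma sortWord_nil (T : ℕ → ℕ) : sortWord T [] = T := rfl

@[simp] lemma sortWord_cons (T : ℕ → ℕ) (i : ℕ) (Q : List ℕ) :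
    sortWord T (i :: Q) = sortWord (sortStep T i) Q := rfl

@[simp] lemma sortWord_append (T : ℕ → ℕ) (Q Q' : List ℕ) :
    sortWord T (Q ++ Q') = sortWord (sortWord T Q) Q' := List.foldl_append

lemma inversions_finite {v : Equiv.Perm ℕ} (hv : FinitelySupported v) :
    {p : ℕ × ℕ | p.1 < p.2 ∧ v p.2 < v p.1}.Finite := by
  obtain ⟨N, hN⟩ := hv.bddAbove
  have fix : ∀ x, N < x → v x = x := by
    intro x hx
    by_contra h
    exact absurd (hN h) (by omega)
  have small : ∀ x, x ≤ N → v x ≤ N := by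
    intro x hx
    by_contra h
    have := v.injective (fix (v x) (by omega))
    omega
  refine ((Set.finite_Iic N).prod (Set.finite_Iic N)).subset ?_
  rintro ⟨x, y⟩ ⟨hxy, hv⟩
  simp only at hxy hv
  have hy : y ≤ N := by
    by_contra hy
    rw [fix y (by omega)] at hv
    by_cases hx : x ≤ N
    · have := small x hx
      omega
    · rw [fix x (by omega)] at hv
      omega
  exact ⟨by simp; omega, by simpa using hy⟩

lemma FinitelySupported.mul_simpleReflection {v : Equiv.Perm ℕ} (hv : FinitelySupported v)
    (i : ℕ) : FinitelySupported (v * simpleReflection i) := by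
  refine (hv.union (Set.toFinite {i, i + 1})).subset ?_
  intro x hx
  by_contra h
  simp only [Set.mem_union, Set.mem_ofPred_eq, Set.mem_insert_iff, Set.mem_singleton_iff,
    not_or, not_not] at h
  apply hx
  rw [Equiv.Perm.mul_apply, simpleReflection, Equiv.swap_apply_of_ne_of_ne h.2.1 h.2.2, h.1]

lemma simpleReflection_lt {i x y : ℕ} (hxy : x < y) (h : ¬ (x = i ∧ y = i + 1)) :
    simpleReflection i x < simpleReflection i y := by
  simp only [simpleReflection, Equiv.swap_apply_def]
  split_ifs <;> omega

lemma length_mul_simpleReflection {v : Equiv.Perm ℕ} (hv : FinitelySupported v) {i : ℕ}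
    (h : v i < v (i + 1)) : length (v * simpleReflection i) = length v + 1 := by
  have key : {p : ℕ × ℕ | p.1 < p.2 ∧ (v * simpleReflection i) p.2 < (v * simpleReflection i) p.1}
      = insert (i, i + 1) (Prod.map (simpleReflection i) (simpleReflection i) ''
          {p : ℕ × ℕ | p.1 < p.2 ∧ v p.2 < v p.1}) := by
    ext ⟨x, y⟩
    simp only [Set.mem_ofPred_eq, Set.mem_insert_iff, Prod.mk.injEq, Set.mem_image, Prod.exists,
      Prod.map_apply, Equiv.Perm.mul_apply]
    constructor
    · rintro ⟨hxy, hlt⟩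
      by_cases hc : x = i ∧ y = i + 1
      · exact Or.inl hc
      · exact Or.inr ⟨_, _, ⟨simpleReflection_lt hxy hc, hlt⟩,
          by simp [simpleReflection], by simp [simpleReflection]⟩
    · rintro (⟨rfl, rfl⟩ | ⟨a, b, ⟨hab, hlt⟩, rfl, rfl⟩)
      · simpa [simpleReflection] using h
      · have hc : ¬ (a = i ∧ b = i + 1) := by
          rintro ⟨rfl, rfl⟩
          omega
        exact ⟨simpleReflection_lt hab hc, by simpa [simpleReflection] using hlt⟩
  have hinj : Function.Injective (Prod.map (simpleReflection i) (simpleReflection i)) :=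
    (simpleReflection i).injective.prodMap (simpleReflection i).injective
  rw [length, key, Set.ncard_insert_of_notMem _ ((inversions_finite hv).image _),
    Set.ncard_image_of_injective _ hinj, length]
  rintro ⟨⟨a, b⟩, ⟨hab, -⟩, he⟩
  simp only [Prod.map_apply, Prod.mk.injEq, simpleReflection] at he hab
  rw [Equiv.swap_apply_eq_iff, Equiv.swap_apply_eq_iff, Equiv.swap_apply_left,
    Equiv.swap_apply_right] at he
  omega

lemma length_lt_mul_simpleReflection_iff {v : Equiv.Perm ℕ} (hv : FinitelySupported v) (i : ℕ) :
    length v < length (v * simpleReflection i) ↔ v i < v (i + 1) := by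
  refine ⟨fun h => ?_, fun h => by rw [length_mul_simpleReflection hv h]; omega⟩
  by_contra hc
  have hne : v i ≠ v (i + 1) := fun h => by simpa using v.injective h
  have h2 := length_mul_simpleReflection (hv.mul_simpleReflection i) (i := i)
    (by simp [simpleReflection]; omega)
  have h3 : v * simpleReflection i * simpleReflection i = v := by
    simp [mul_assoc, simpleReflection]
  rw [h3] at h2
  omega

lemma FinitelySupported.demazureMul {v : Equiv.Perm ℕ} (hv : FinitelySupported v) (i : ℕ) :
    FinitelySupported (demazureMul v i) := by
  unfold LacingDiagrams.demazureMul
  split_ifs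
  exacts [hv.mul_simpleReflection i, hv]

lemma coe_demazureMul {v : Equiv.Perm ℕ} (hv : FinitelySupported v) (i : ℕ) :
    ⇑(demazureMul v i) = sortStep v i := by
  unfold demazureMul sortStep
  simp only [length_lt_mul_simpleReflection_iff hv]
  split_ifs <;> rfl

lemma foldl_demazureMul {v : Equiv.Perm ℕ} (hv : FinitelySupported v) (Q : List ℕ) :
    FinitelySupported (Q.foldl demazureMul v) ∧ ⇑(Q.foldl demazureMul v) = sortWord v Q := by
  induction Q generalizing v with
  | nil => exact ⟨hv, rfl⟩
  | cons i Q ih =>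
    rw [List.foldl_cons, sortWord_cons, ← coe_demazureMul hv]
    exact ih (hv.demazureMul i)

lemma coe_wordDemazure (Q : List ℕ) : ⇑(wordDemazure Q) = sortWord id Q :=
  (foldl_demazureMul (v := 1) (by simp [FinitelySupported]) Q).2

lemma sortStep_apply_of_ne (T : ℕ → ℕ) {i x : ℕ} (h : x ≠ i) (h' : x ≠ i + 1) :
    sortStep T i x = T x := by
  unfold sortStep
  split_ifs
  · simp [Equiv.swap_apply_of_ne_of_ne h h']
  · rfl

lemma sortWord_apply_of_forall_ne (T : ℕ → ℕ) {Q : List ℕ} {x : ℕ}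
    (h : ∀ i ∈ Q, x ≠ i ∧ x ≠ i + 1) : sortWord T Q x = T x := by
  induction Q generalizing T with
  | nil => rfl
  | cons i Q ih =>
    rw [sortWord_cons, ih _ fun j hj => h j (List.mem_cons_of_mem _ hj),
      sortStep_apply_of_ne _ (h i List.mem_cons_self).1 (h i List.mem_cons_self).2]

lemma sortStep_injective {T : ℕ → ℕ} (hT : T.Injective) (i : ℕ) :
    (sortStep T i).Injective := by
  unfold sortStep
  split_ifs
  exacts [hT.comp (Equiv.injective _), hT]

lemma sortWord_injective {T : ℕ → ℕ} (hT : T.Injective) (Q : List ℕ) :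
    (sortWord T Q).Injective := by
  induction Q generalizing T with
  | nil => exact hT
  | cons i Q ih => exact ih (sortStep_injective hT i)

lemma sortWord_forall {T : ℕ → ℕ} {p : ℕ → Prop} (hT : ∀ x, p (T x)) (Q : List ℕ) (x : ℕ) :
    p (sortWord T Q x) := by
  induction Q generalizing T with
  | nil => exact hT x
  | cons i Q ih =>
    refine ih fun y => ?_
    unfold sortStep
    split_ifs
    exacts [hT _, hT _]

lemma sortWord_lt {T : ℕ → ℕ} {N : ℕ} {Q : List ℕ} (hQ : ∀ i ∈ Q, i + 2 ≤ N)
    (hT : ∀ x < N, T x < N) {x : ℕ} (hx : x < N) : sortWord T Q x < N := by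
  induction Q generalizing T with
  | nil => exact hT x hx
  | cons i Q ih =>
    have hi := hQ i List.mem_cons_self
    refine ih (fun j hj => hQ j (List.mem_cons_of_mem _ hj)) fun y hy => ?_
    unfold sortStep
    split_ifs
    · refine hT _ ?_
      rw [Equiv.swap_apply_def]
      split_ifs <;> omega
    · exact hT y hy

lemma sortWord_strictMono_comp {ψ : ℕ → ℕ} (hψ : StrictMono ψ) (T : ℕ → ℕ) (Q : List ℕ) :
    sortWord (ψ ∘ T) Q = ψ ∘ sortWord T Q := by
  induction Q generalizing T with
  | nil => rfl
  | cons i Q ih =>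
    rw [sortWord_cons, sortWord_cons, ← ih]
    congr 1
    simp only [sortStep, Function.comp_apply, hψ.lt_iff_lt]
    split_ifs <;> rfl

/-- The sequence `f 0, …, f (c - 1), A 0, A 1, …`. -/
def prepend (c : ℕ) (f A : ℕ → ℕ) : ℕ → ℕ :=
  fun i => if i < c then f i else A (i - c)

lemma prepend_of_lt {c i : ℕ} (f A : ℕ → ℕ) (h : i < c) : prepend c f A i = f i := if_pos h

@[simp] lemma prepend_add (c i : ℕ) (f A : ℕ → ℕ) : prepend c f A (c + i) = A i := by
  simp [prepend]

lemma sortStep_prepend (c : ℕ) (f A : ℕ → ℕ) (i : ℕ) :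
    sortStep (prepend c f A) (c + i) = prepend c f (sortStep A i) := by
  have h1 : prepend c f A (c + i + 1) = A (i + 1) := by rw [add_assoc, prepend_add]
  unfold sortStep
  rw [prepend_add, h1]
  split_ifs
  · funext x
    rcases lt_or_ge x c with hx | hx
    · rw [Function.comp_apply, Equiv.swap_apply_of_ne_of_ne (by omega) (by omega),
        prepend_of_lt _ _ hx, prepend_of_lt _ _ hx]
    · obtain ⟨y, rfl⟩ := Nat.exists_eq_add_of_le hx
      rw [prepend_add]
      simp only [Function.comp_apply, Equiv.swap_apply_def]
      split_ifs with h2 h3 h4 h5 h6 h7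
      all_goals first | omega | simp
  · rfl

lemma sortWord_prepend (c : ℕ) (f A : ℕ → ℕ) (Q : List ℕ) :
    sortWord (prepend c f A) (Q.map (c + ·)) = prepend c f (sortWord A Q) := by
  induction Q generalizing A with
  | nil => rfl
  | cons i Q ih => rw [List.map_cons, sortWord_cons, sortStep_prepend, ih, sortWord_cons]

/-- The descending run `c - 1, …, 1, 0` carries the entry in position `c` to the front, if that
entry is larger than all the entries before it. -/
lemma sortWord_reverse_range {c : ℕ} {T : ℕ → ℕ} (h : ∀ t < c, T t < T c) :
    sortWord T (List.range c).reverse =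
      fun i => if i = 0 then T c else if i ≤ c then T (i - 1) else T i := by
  induction c generalizing T with
  | zero =>
    funext i
    rcases i with _ | i <;> simp
  | succ c ih =>
    rw [List.range_succ, List.reverse_append, List.reverse_singleton, List.singleton_append,
      sortWord_cons]
    have hs : sortStep T c = T ∘ Equiv.swap c (c + 1) := if_pos (h c (by omega))
    have h0 : ∀ t < c, (T ∘ Equiv.swap c (c + 1)) t = T t := fun t ht => by
      rw [Function.comp_apply, Equiv.swap_apply_of_ne_of_ne (by omega) (by omega)]
    have hc : (T ∘ Equiv.swap c (c + 1)) c = T (c + 1) := by simp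
    rw [hs, ih fun t ht => by rw [h0 t ht, hc]; exact h t (by omega)]
    funext i
    rw [hc]
    rcases lt_trichotomy i (c + 1) with hi | rfl | hi
    · rcases Nat.eq_zero_or_pos i with rfl | hp
      · simp
      · rw [if_neg (by omega), if_pos (by omega), if_neg (by omega), if_pos (by omega),
          h0 _ (by omega)]
    · simp
    · rw [if_neg (by omega), if_neg (by omega), if_neg (by omega), if_neg (by omega),
        Function.comp_apply, Equiv.swap_apply_of_ne_of_ne (by omega) (by omega)]

/-! ### Rank functions of Demazure products -/

/-- The rank function of a sequence: the number of positions `x ≥ a` whose entry is less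
than `b`.  It is used for injective sequences only, for which this number is finite. -/
noncomputable def rankFn (T : ℕ → ℕ) (a b : ℕ) : ℕ :=
  {x | a ≤ x ∧ T x < b}.ncard

lemma rankFn_finite {T : ℕ → ℕ} (hT : T.Injective) (a b : ℕ) :
    {x | a ≤ x ∧ T x < b}.Finite :=
  ((Set.finite_Iio b).preimage hT.injOn).subset fun _ hx => hx.2

lemma rankFn_succ {T : ℕ → ℕ} (hT : T.Injective) (a b : ℕ) :
    rankFn T a b = rankFn T (a + 1) b + if T a < b then 1 else 0 := by
  unfold rankFn
  split_ifs with h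
  · rw [← Set.ncard_insert_of_notMem (a := a) (by simp) (rankFn_finite hT _ _)]
    congr 1
    ext x
    simp only [Set.mem_ofPred_eq, Set.mem_insert_iff]
    constructor
    · rintro ⟨h1, h2⟩
      by_cases hx : x = a
      · exact Or.inl hx
      · exact Or.inr ⟨by omega, h2⟩
    · rintro (rfl | ⟨h1, h2⟩)
      · exact ⟨le_rfl, h⟩
      · exact ⟨by omega, h2⟩
  · congr 1
    ext x
    simp only [Set.mem_ofPred_eq]
    constructor
    · rintro ⟨h1, h2⟩
      have : x ≠ a := by
        rintro rfl
        exact h h2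
      exact ⟨by omega, h2⟩
    · rintro ⟨h1, h2⟩
      exact ⟨by omega, h2⟩

lemma rankFn_id (a b : ℕ) : rankFn id a b = b - a := by
  have : {x : ℕ | a ≤ x ∧ id x < b} = Set.Ico a b := rfl
  rw [rankFn, this, ← Finset.coe_Ico, Set.ncard_coe_finset, Nat.card_Ico]

lemma rankFn_le_add_left {T : ℕ → ℕ} (hT : T.Injective) (a b l : ℕ) :
    rankFn T a b ≤ (l - a) + rankFn T l b := by
  rcases le_or_gt l a with h | h
  · refine le_add_of_le_right (Set.ncard_le_ncard ?_ (rankFn_finite hT l b))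
    exact fun x hx => ⟨h.trans hx.1, hx.2⟩
  · induction l, h using Nat.le_induction with
    | base =>
      rw [rankFn_succ hT a b, Nat.succ_eq_add_one]
      split_ifs <;> omega
    | succ l hl ih =>
      have := rankFn_succ hT l b
      split_ifs at this <;> omega

lemma rankFn_le_add_right {T : ℕ → ℕ} (hT : T.Injective) (a b l : ℕ) :
    rankFn T a b ≤ rankFn T a l + (b - l) := by
  rcases le_or_gt b l with h | h
  · refine le_add_of_le_left (Set.ncard_le_ncard ?_ (rankFn_finite hT a l))
    exact fun x hx => ⟨hx.1, hx.2.trans_le h⟩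
  · have hsub : {x | a ≤ x ∧ T x < b} ⊆ {x | a ≤ x ∧ T x < l} ∪ T ⁻¹' (Set.Ico l b) := by
      rintro x ⟨h1, h2⟩
      by_cases hx : T x < l
      · exact Or.inl ⟨h1, hx⟩
      · exact Or.inr ⟨by omega, h2⟩
    have hfin : (T ⁻¹' (Set.Ico l b)).Finite := (Set.finite_Ico l b).preimage hT.injOn
    refine (Set.ncard_le_ncard hsub ((rankFn_finite hT a l).union hfin)).trans
      ((Set.ncard_union_le _ _).trans (Nat.add_le_add_left ?_ _))
    rw [← Set.ncard_image_of_injective _ hT]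
    refine (Set.ncard_le_ncard (Set.image_preimage_subset _ _) (Set.finite_Ico l b)).trans ?_
    rw [← Finset.coe_Ico, Set.ncard_coe_finset, Nat.card_Ico]

lemma eq_of_rankFn_eq {T T' : ℕ → ℕ} (hT : T.Injective) (hT' : T'.Injective)
    (h : ∀ a b, rankFn T a b = rankFn T' a b) : T = T' := by
  funext a
  have key : ∀ b, T a < b ↔ T' a < b := by
    intro b
    have h1 := rankFn_succ hT a b
    have h2 := rankFn_succ hT' a b
    rw [h, h] at h1
    split_ifs at h1 h2 <;> omega
  have h1 := (key (T a + 1)).1 (by omega)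
  have h2 := (key (T' a + 1)).2 (by omega)
  omega

lemma rankFn_sortStep_of_ne {T : ℕ → ℕ} {a i : ℕ} (h : a ≠ i + 1) (b : ℕ) :
    rankFn (sortStep T i) a b = rankFn T a b := by
  unfold sortStep
  split_ifs
  · have : {x | a ≤ x ∧ (T ∘ Equiv.swap i (i + 1)) x < b}
        = Equiv.swap i (i + 1) '' {x | a ≤ x ∧ T x < b} := by
      ext x
      rw [Set.mem_image_equiv]
      simp only [Equiv.symm_swap, Set.mem_ofPred_eq, Function.comp_apply]
      have : a ≤ x ↔ a ≤ Equiv.swap i (i + 1) x := by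
        rw [Equiv.swap_apply_def]
        split_ifs <;> omega
      rw [← this]
    rw [rankFn, this, Set.ncard_image_of_injective _ (Equiv.injective _), rankFn]
  · rfl

lemma rankFn_sortStep_self {T : ℕ → ℕ} (hT : T.Injective) (i b : ℕ) :
    rankFn (sortStep T i) (i + 1) b = min (rankFn T i b) (rankFn T (i + 2) b + 1) := by
  have h1 := rankFn_succ hT i b
  have h2 := rankFn_succ hT (i + 1) b
  have h3 := rankFn_succ (sortStep_injective hT i) (i + 1) b
  rw [rankFn_sortStep_of_ne (a := i + 1 + 1) (by omega)] at h3
  rw [add_assoc] at h2 h3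
  norm_num only at h2 h3
  have h4 : sortStep T i (i + 1) = min (T i) (T (i + 1)) := by
    unfold sortStep
    split_ifs with h
    · simp [h.le]
    · rw [min_eq_right (by omega)]
  rw [h4] at h3
  rcases le_total (T i) (T (i + 1)) with h | h
  · rw [min_eq_left h] at h3
    split_ifs at h1 h2 h3 <;> omega
  · rw [min_eq_right h] at h3
    split_ifs at h1 h2 h3 <;> omega

lemma rankFn_le_sortWord {T : ℕ → ℕ} (hT : T.Injective) (Q : List ℕ) (a b : ℕ) :
    rankFn T a b ≤ rankFn (sortWord T Q) a b := by
  induction Q generalizing T with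
  | nil => rfl
  | cons i Q ih =>
    refine le_trans ?_ (ih (sortStep_injective hT i))
    by_cases h : a = i + 1
    · subst h
      rw [rankFn_sortStep_self hT, le_min_iff]
      refine ⟨?_, ?_⟩
      · rw [rankFn_succ hT i]
        omega
      · rw [rankFn_succ hT (i + 1), add_assoc]
        split_ifs <;> omega
    · rw [rankFn_sortStep_of_ne h]

/-- The rank function of a Demazure product is the product of the two rank functions in the
min-plus algebra. -/
theorem rankFn_sortWord {A : ℕ → ℕ} (hA : A.Injective) (Q : List ℕ) (a b : ℕ) :
    IsLeast (Set.range fun l => rankFn (sortWord id Q) a l + rankFn A l b)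
      (rankFn (sortWord A Q) a b) := by
  induction Q using List.reverseRecOn generalizing a with
  | nil =>
    refine ⟨⟨a, by simp [rankFn_id]⟩, ?_⟩
    rintro _ ⟨l, rfl⟩
    simpa [rankFn_id] using rankFn_le_add_left hA a b l
  | append_singleton Q i ih =>
    have hid := sortWord_injective Function.injective_id Q
    simp only [sortWord_append, sortWord_cons, sortWord_nil]
    by_cases h : a = i + 1
    · subst h
      rw [rankFn_sortStep_self (sortWord_injective hA Q)]
      simp only [rankFn_sortStep_self hid]
      obtain ⟨⟨l, hl⟩, h1⟩ := ih i
      obtain ⟨⟨l', hl'⟩, h2⟩ := ih (i + 2)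
      simp only at hl hl'
      constructor
      · rcases le_total (rankFn (sortWord A Q) i b) (rankFn (sortWord A Q) (i + 2) b + 1)
          with hle | hle
        · refine ⟨l, ?_⟩
          have := h2 ⟨l, rfl⟩
          simp only at this ⊢
          omega
        · refine ⟨l', ?_⟩
          have := h1 ⟨l', rfl⟩
          simp only at this ⊢
          omega
      · rintro _ ⟨k, rfl⟩
        have h3 := h1 ⟨k, rfl⟩
        have h4 := h2 ⟨k, rfl⟩
        simp only at h3 h4 ⊢
        omega
    · simp only [rankFn_sortStep_of_ne h]
      exact ih a

/-- Sorting by words with the same Demazure product gives the same result. -/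
theorem sortWord_congr {A : ℕ → ℕ} (hA : A.Injective) {Q Q' : List ℕ}
    (h : sortWord id Q = sortWord id Q') : sortWord A Q = sortWord A Q' := by
  refine eq_of_rankFn_eq (sortWord_injective hA _) (sortWord_injective hA _) fun a b => ?_
  have h1 := rankFn_sortWord hA Q a b
  rw [h] at h1
  exact h1.unique (rankFn_sortWord hA Q' a b)

lemma rankFn_sortStep_id (i l b : ℕ) :
    rankFn (sortStep id i) l b = (b - l) + if l = i + 1 ∧ b = i + 1 then 1 else 0 := by
  by_cases h : l = i + 1
  · subst h
    rw [rankFn_sortStep_self Function.injective_id, rankFn_id, rankFn_id]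
    split_ifs <;> omega
  · rw [rankFn_sortStep_of_ne h, rankFn_id, if_neg (by tauto), add_zero]

lemma rankFn_sortWord_cons_of_ne {i b : ℕ} (h : b ≠ i + 1) (Q : List ℕ) (a : ℕ) :
    rankFn (sortWord id (i :: Q)) a b = rankFn (sortWord id Q) a b := by
  have hid := sortWord_injective Function.injective_id Q
  refine (rankFn_sortWord (sortStep_injective Function.injective_id i) Q a b).unique
    ⟨⟨b, ?_⟩, ?_⟩
  · simp [rankFn_sortStep_id, h]
  · rintro _ ⟨l, rfl⟩
    have := rankFn_le_add_right hid a b l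
    simp only [rankFn_sortStep_id]
    omega

lemma rankFn_sortWord_cons_self (i : ℕ) (Q : List ℕ) (a : ℕ) :
    rankFn (sortWord id (i :: Q)) a (i + 1) =
      min (rankFn (sortWord id Q) a i + 1) (rankFn (sortWord id Q) a (i + 2)) := by
  have hid := sortWord_injective Function.injective_id Q
  refine (rankFn_sortWord (sortStep_injective Function.injective_id i) Q a (i + 1)).unique
    ⟨?_, ?_⟩
  · rcases le_total (rankFn (sortWord id Q) a i + 1) (rankFn (sortWord id Q) a (i + 2))
      with h | h
    · exact ⟨i, by simp [rankFn_sortStep_id, h]⟩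
    · exact ⟨i + 2, by simp [rankFn_sortStep_id, h]⟩
  · rintro _ ⟨l, rfl⟩
    have h1 := rankFn_le_add_right hid a (i + 1) l
    have h2 := rankFn_le_add_right hid a i l
    have h3 := rankFn_le_add_right hid a (i + 2) l
    have h4 := rankFn_le_add_right hid a (i + 2) (i + 1)
    simp only [rankFn_sortStep_id]
    split_ifs with h
    · obtain ⟨rfl, -⟩ := h
      omega
    · rcases lt_trichotomy l (i + 1) with hl | hl | hl
      · omega
      · simp [hl] at h
      · omega

/-- The reverse of the word `Q`, with every letter `i` replaced by `N - 2 - i`. -/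
def reverseComplement (N : ℕ) (Q : List ℕ) : List ℕ :=
  (Q.map (N - 2 - ·)).reverse

/-- The reverse complement of a word corresponds to the inverse of the Demazure product,
conjugated by the longest permutation of `0, …, N - 1`; this reflects the rank function. -/
lemma rankFn_reverseComplement {N : ℕ} {Q : List ℕ} (hQ : ∀ i ∈ Q, i + 2 ≤ N) {a b : ℕ}
    (ha : a ≤ N) (hb : b ≤ N) :
    rankFn (sortWord id (reverseComplement N Q)) a b =
      rankFn (sortWord id Q) (N - b) (N - a) := by
  induction Q using List.reverseRecOn generalizing a b with
  | nil =>
    simp only [reverseComplement, List.map_nil, List.reverse_nil, sortWord_nil, rankFn_id]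
    omega
  | append_singleton Q i ih =>
    have hi : i + 2 ≤ N := hQ i (by simp)
    have ih' := @ih fun j hj => hQ j (by simp [hj])
    have hcons : reverseComplement N (Q ++ [i]) = (N - 2 - i) :: reverseComplement N Q := by
      simp [reverseComplement]
    have hid := sortWord_injective Function.injective_id Q
    rw [hcons, sortWord_append, sortWord_cons (sortWord id Q), sortWord_nil]
    by_cases h : b = N - 2 - i + 1
    · subst h
      rw [rankFn_sortWord_cons_self, ih' ha (by omega), ih' ha (by omega),
        show N - (N - 2 - i + 1) = i + 1 by omega, rankFn_sortStep_self hid,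
        show N - (N - 2 - i) = i + 2 by omega, show N - (N - 2 - i + 2) = i by omega, min_comm]
    · rw [rankFn_sortWord_cons_of_ne h, rankFn_sortStep_of_ne (by omega), ih' ha hb]

/-- The reverse complement of a word respects Demazure products. -/
theorem sortWord_reverseComplement_congr {N : ℕ} {Q Q' : List ℕ} (hQ : ∀ i ∈ Q, i + 2 ≤ N)
    (hQ' : ∀ i ∈ Q', i + 2 ≤ N) (h : sortWord id Q = sortWord id Q') :
    sortWord id (reverseComplement N Q) = sortWord id (reverseComplement N Q') := by
  have letters : ∀ {R : List ℕ}, (∀ i ∈ R, i + 2 ≤ N) →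
      ∀ i ∈ reverseComplement N R, i + 2 ≤ N := by
    intro R hR i hi
    simp only [reverseComplement, List.mem_reverse, List.mem_map] at hi
    obtain ⟨j, hj, rfl⟩ := hi
    have := hR j hj
    omega
  have hl := letters hQ
  have hl' := letters hQ'
  have hinj := sortWord_injective Function.injective_id (reverseComplement N Q)
  have hinj' := sortWord_injective Function.injective_id (reverseComplement N Q')
  funext a
  rcases lt_or_ge a N with ha | ha
  · have key : ∀ b ≤ N, sortWord id (reverseComplement N Q) a < b ↔
        sortWord id (reverseComplement N Q') a < b := by
      intro b hb
      have h1 := rankFn_succ hinj a b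
      have h2 := rankFn_succ hinj' a b
      rw [rankFn_reverseComplement hQ (by omega) hb,
        rankFn_reverseComplement hQ (by omega) hb, h] at h1
      rw [rankFn_reverseComplement hQ' (by omega) hb,
        rankFn_reverseComplement hQ' (by omega) hb] at h2
      split_ifs at h1 h2 <;> omega
    have h1 := sortWord_lt hl (T := id) (fun x hx => hx) ha
    have h2 := sortWord_lt hl' (T := id) (fun x hx => hx) ha
    have h3 := (key _ h1).1 (Nat.lt_succ_self _)
    have h4 := (key _ h2).2 (Nat.lt_succ_self _)
    omega
  · rw [sortWord_apply_of_forall_ne, sortWord_apply_of_forall_ne]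
    · intro i hi
      have := hl' i hi
      omega
    · intro i hi
      have := hl i hi
      omega

/-- A Demazure product that fixes all `x ≥ D` comes from a word in the simple reflections that
fix all `x ≥ D`: once a letter `i` has been read, `{0, …, i}` is never stable again. -/
lemma letters_lt_of_fixes {Q : List ℕ} {D : ℕ} (h : ∀ x, D ≤ x → sortWord id Q x = x) {i : ℕ}
    (hi : i ∈ Q) : i + 1 < D := by
  by_contra hD
  have h0 : rankFn (sortWord id Q) (i + 1) (i + 1) = 0 := by
    rw [rankFn]
    convert Set.ncard_empty ℕ
    ext x
    simp only [Set.mem_ofPred_eq, Set.mem_empty_iff_false, iff_false, not_and, not_lt]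
    intro hx
    rwa [h x (by omega)]
  obtain ⟨Q₁, Q₂, rfl⟩ := List.append_of_mem hi
  rw [sortWord_append, sortWord_cons] at h0
  have hinj := sortWord_injective Function.injective_id Q₁
  have h1 := rankFn_le_sortWord (sortStep_injective hinj i) Q₂ (i + 1) (i + 1)
  have h2 := rankFn_sortStep_self hinj i (i + 1)
  have h3 := rankFn_le_sortWord Function.injective_id Q₁ i (i + 1)
  rw [rankFn_id] at h3
  omega

/-! ### Reading a pipe dream row by row -/

/-- The sorting process row by row: the word of row `x`, with columns `cols x`, is applied to the
current sequence, whose first entry is then split off.  `tailSeq T cols x` is the sequence that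
is left when the rows before `x` have been read. -/
def tailSeq (T : ℕ → ℕ) (cols : ℕ → List ℕ) : ℕ → ℕ → ℕ
  | 0 => T
  | x + 1 => fun i => sortWord (tailSeq T cols x) (cols x) (i + 1)

/-- The entry that is split off after row `x` has been read. -/
def headSeq (T : ℕ → ℕ) (cols : ℕ → List ℕ) (x : ℕ) : ℕ :=
  sortWord (tailSeq T cols x) (cols x) 0

lemma sortWord_flatMap (T : ℕ → ℕ) (cols : ℕ → List ℕ) (k : ℕ) :
    sortWord T ((List.range k).flatMap fun x => (cols x).map (x + ·)) =
      prepend k (headSeq T cols) (tailSeq T cols k) := by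
  induction k with
  | zero =>
    funext i
    simp [prepend, tailSeq]
  | succ k ih =>
    rw [List.range_succ, List.flatMap_append, sortWord_append, ih, List.flatMap_singleton,
      sortWord_prepend]
    funext i
    rcases lt_trichotomy i k with h | rfl | h
    · rw [prepend_of_lt _ _ h, prepend_of_lt _ _ (by omega)]
    · rw [prepend_of_lt _ _ (Nat.lt_succ_self i)]
      simp [prepend, headSeq]
    · obtain ⟨j, rfl⟩ := Nat.exists_eq_add_of_lt h
      rw [show k + j + 1 = k + (j + 1) by ring, prepend_add,
        show k + (j + 1) = (k + 1) + j by ring, prepend_add]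
      rfl

lemma tailSeq_add (T : ℕ → ℕ) (cols : ℕ → List ℕ) (x t : ℕ) :
    tailSeq T cols (x + t) = tailSeq (tailSeq T cols x) (fun y => cols (x + y)) t := by
  induction t with
  | zero => rfl
  | succ t ih =>
    funext i
    change sortWord (tailSeq T cols (x + t)) (cols (x + t)) (i + 1) = _
    rw [ih]
    rfl

lemma headSeq_add (T : ℕ → ℕ) (cols : ℕ → List ℕ) (x t : ℕ) :
    headSeq T cols (x + t) = headSeq (tailSeq T cols x) (fun y => cols (x + y)) t := by
  rw [headSeq, tailSeq_add, headSeq]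

lemma tailSeq_of_nil {T : ℕ → ℕ} {cols : ℕ → List ℕ} {x : ℕ} (h : ∀ t, cols (x + t) = [])
    (t i : ℕ) : tailSeq T cols (x + t) i = tailSeq T cols x (t + i) := by
  induction t generalizing i with
  | zero => simp
  | succ t ih =>
    change sortWord (tailSeq T cols (x + t)) (cols (x + t)) (i + 1) = _
    rw [h, sortWord_nil, ih]
    congr 1
    ring

lemma headSeq_of_nil {T : ℕ → ℕ} {cols : ℕ → List ℕ} {x : ℕ} (h : ∀ t, cols (x + t) = [])
    (t : ℕ) : headSeq T cols (x + t) = tailSeq T cols x t := by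
  rw [headSeq, h, sortWord_nil, tailSeq_of_nil h, add_zero]

lemma le_tailSeq {T : ℕ → ℕ} {c : ℕ} (hT : ∀ i, c ≤ T i) (cols : ℕ → List ℕ) (x i : ℕ) :
    c ≤ tailSeq T cols x i := by
  induction x generalizing i with
  | zero => exact hT i
  | succ x ih => exact sortWord_forall (p := fun y => c ≤ y) ih _ _

/-- A `k`-rowed strip with crosses in its first `c` columns splits off the same entries as the
part of the strip that lies to the right of these columns: `0, …, c - 1` stay in front. -/
lemma tailSeq_prepend {T A : ℕ → ℕ} {cols Z : ℕ → List ℕ} {c k : ℕ} (hT : T = prepend c id A)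
    (hA : ∀ i, c ≤ A i)
    (hcols : ∀ t < k, cols t = (Z t).map (c + ·) ++ (List.range c).reverse) :
    (∀ t ≤ k, tailSeq T cols t = prepend c id (tailSeq A Z t)) ∧
      ∀ t < k, headSeq T cols t = headSeq A Z t := by
  have step : ∀ t < k, tailSeq T cols t = prepend c id (tailSeq A Z t) →
      sortWord (tailSeq T cols t) (cols t) =
        fun i => if i = 0 then headSeq A Z t else if i ≤ c then i - 1
          else tailSeq A Z (t + 1) (i - (c + 1)) := by
    intro t ht h
    have hB : ∀ i, c ≤ sortWord (tailSeq A Z t) (Z t) i :=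
      sortWord_forall (p := fun y => c ≤ y) (le_tailSeq hA Z t) _
    have hc : prepend c id (sortWord (tailSeq A Z t) (Z t)) c = headSeq A Z t := by
      simp [prepend, headSeq]
    rw [h, hcols t ht, sortWord_append, sortWord_prepend, sortWord_reverse_range]
    · funext i
      rw [hc]
      rcases Nat.eq_zero_or_pos i with rfl | hi
      · simp
      · simp only [if_neg hi.ne']
        rcases le_or_gt i c with hic | hic
        · rw [if_pos hic, if_pos hic, prepend_of_lt _ _ (by omega), id]
        · rw [if_neg (by omega), if_neg (by omega)]
          obtain ⟨j, rfl⟩ := Nat.exists_eq_add_of_lt hic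
          rw [add_assoc, prepend_add, ← add_assoc,
            show c + j + 1 - (c + 1) = j by omega]
          rfl
    · intro s hs
      rw [hc, prepend_of_lt _ _ hs]
      exact lt_of_lt_of_le hs (hB 0)
  have main : ∀ t ≤ k, tailSeq T cols t = prepend c id (tailSeq A Z t) := by
    intro t
    induction t with
    | zero => exact fun _ => hT
    | succ t ih =>
      intro ht
      funext i
      change sortWord (tailSeq T cols t) (cols t) (i + 1) = _
      rw [step t (by omega) (ih (by omega))]
      rcases lt_or_ge i c with hi | hi
      · simp [prepend, hi, Nat.succ_le_of_lt hi]
      · simp [prepend, hi.not_gt]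
  refine ⟨main, fun t ht => ?_⟩
  rw [headSeq, step t ht (main t ht.le)]
  rfl

open Classical in
/-- The columns of the crosses in row `x` of a pipe dream, from right to left. -/
noncomputable def PipeDream.cols {k l : ℕ} (P : PipeDream k l) (x : ℕ) : List ℕ :=
  (List.range l).reverse.filter fun y => ∃ (hx : x < k) (hy : y < l), (⟨x, hx⟩, ⟨y, hy⟩) ∈ P

lemma PipeDream.word_eq_finRange {k l : ℕ} (P : PipeDream k l) :
    P.word = (List.finRange k).flatMap fun p =>
      ((List.finRange l).reverse.filter fun q => (p, q) ∈ P).map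
        fun q : Fin l => (p : ℕ) + (q : ℕ) := by
  refine List.flatMap_congr fun p _ => ?_
  have h : ∀ M : List (Fin l), (do let a ← M; pure (a : ℕ)) = M.map fun q : Fin l => (q : ℕ) :=
    fun M => List.map_eq_flatMap.symm
  rw [h, List.map_map]
  rfl

lemma PipeDream.word_eq {k l : ℕ} (P : PipeDream k l) :
    P.word = (List.range k).flatMap fun x => (P.cols x).map (x + ·) := by
  rw [P.word_eq_finRange, ← List.map_coe_finRange_eq_range, List.flatMap_map]
  refine List.flatMap_congr fun p _ => ?_
  rw [PipeDream.cols, ← List.map_coe_finRange_eq_range, ← List.map_reverse, List.filter_map,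
    List.map_map]
  congr 1
  refine List.filter_congr fun q _ => ?_
  simp

lemma PipeDream.cols_eq_nil {k l : ℕ} (P : PipeDream k l) {x : ℕ} (hx : k ≤ x) :
    P.cols x = [] := by
  simp only [PipeDream.cols, List.filter_eq_nil_iff, decide_eq_true_eq, not_exists]
  intro _ _ h
  omega

lemma PipeDream.cols_sortWord {k l : ℕ} (P : PipeDream k l) (A : ℕ → ℕ) :
    sortWord A P.word = headSeq A P.cols := by
  rw [P.word_eq, sortWord_flatMap]
  funext i
  rcases lt_or_ge i k with hi | hi
  · rw [prepend_of_lt _ _ hi]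
  · obtain ⟨j, rfl⟩ := Nat.exists_eq_add_of_le hi
    rw [prepend_add, headSeq_of_nil fun t => P.cols_eq_nil (by omega)]

lemma PipeDream.tailSeq_cols {k l : ℕ} (P : PipeDream k l) (A : ℕ → ℕ) (i : ℕ) :
    tailSeq A P.cols k i = sortWord A P.word (k + i) := by
  rw [P.cols_sortWord, headSeq_of_nil fun t => P.cols_eq_nil (by omega)]

lemma PipeDream.mem_word {k l : ℕ} (P : PipeDream k l) {i : ℕ} :
    i ∈ P.word ↔ ∃ p q, (p, q) ∈ P ∧ (p : ℕ) + (q : ℕ) = i := by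
  simp [PipeDream.word_eq_finRange]

lemma PipeDream.add_two_le_of_mem_word {k l : ℕ} (P : PipeDream k l) {i : ℕ} (hi : i ∈ P.word) :
    i + 2 ≤ k + l := by
  obtain ⟨p, q, -, rfl⟩ := P.mem_word.1 hi
  omega

lemma PipeDream.coe_demazure {k l : ℕ} (P : PipeDream k l) :
    ⇑P.demazure = sortWord id P.word := coe_wordDemazure _

lemma PipeDream.word_rotate {k l : ℕ} (P : PipeDream k l) :
    P.rotate.word = reverseComplement (k + l) P.word := by
  rw [reverseComplement, PipeDream.word_eq_finRange, PipeDream.word_eq_finRange, List.map_flatMap, List.reverse_flatMap,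
    List.finRange_reverse (n := k), List.flatMap_map]
  refine List.flatMap_congr fun p _ => ?_
  rw [Function.comp_apply, ← List.map_reverse, ← List.map_reverse, ← List.filter_reverse,
    List.reverse_reverse, List.finRange_reverse, List.filter_map, List.map_map, List.map_map]
  have h : ∀ q : Fin l, ((p, q.rev) ∈ P.rotate) = ((p.rev, q) ∈ P) := by
    intro q
    simp [PipeDream.rotate]
  simp only [Function.comp_def, h]
  refine List.map_congr_left fun q _ => ?_
  simp only [Fin.val_rev]
  omega

lemma PipeDream.rotate_rotate {k l : ℕ} (P : PipeDream k l) : P.rotate.rotate = P := by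
  ext ⟨p, q⟩
  simp [PipeDream.rotate]

/-! ### Block decompositions -/

section Blocks

variable {n : ℕ} (b : Fin (n + 1) → ℕ)

lemma rowStart_zero : rowStart b 0 = 0 := by
  simp [rowStart]

lemma rowStart_succ (j : Fin n) :
    rowStart b j.succ = rowStart b j.castSucc + b j.castSucc := by
  have : Finset.univ.filter (fun i => i < j.succ) =
      insert j.castSucc (Finset.univ.filter (fun i => i < j.castSucc)) := by
    ext i
    simp only [Finset.mem_filter, Finset.mem_univ, true_and, Finset.mem_insert, Fin.lt_def,
      Fin.ext_iff, Fin.val_succ, Fin.val_castSucc]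
    omega
  rw [rowStart, this, Finset.sum_insert (by simp), add_comm, rowStart]

lemma rowStart_last : rowStart b (Fin.last n) + b (Fin.last n) = ∑ j, b j := by
  have : (Finset.univ : Finset (Fin (n + 1))) =
      insert (Fin.last n) (Finset.univ.filter (fun i => i < Fin.last n)) := by
    ext i
    simp only [Finset.mem_filter, Finset.mem_univ, true_and, Finset.mem_insert, Fin.lt_def,
      Fin.ext_iff, Fin.val_last, true_iff]
    omega
  conv_rhs => rw [this]
  rw [Finset.sum_insert (by simp), add_comm, rowStart]

lemma colStart_last : colStart b (Fin.last n) = 0 := by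
  rw [colStart, Finset.sum_eq_zero_iff]
  intro i hi
  simp only [Finset.mem_filter, Finset.mem_univ, true_and] at hi
  exact absurd (Fin.le_last i) hi.not_ge

lemma colStart_castSucc (j : Fin n) :
    colStart b j.castSucc = colStart b j.succ + b j.succ := by
  have : Finset.univ.filter (fun i => j.castSucc < i) =
      insert j.succ (Finset.univ.filter (fun i => j.succ < i)) := by
    ext i
    simp only [Finset.mem_filter, Finset.mem_univ, true_and, Finset.mem_insert, Fin.lt_def,
      Fin.ext_iff, Fin.val_succ, Fin.val_castSucc]
    omega
  rw [colStart, this, Finset.sum_insert (by simp), add_comm, colStart]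

lemma colStart_zero : colStart b 0 + b 0 = ∑ j, b j := by
  have : (Finset.univ : Finset (Fin (n + 1))) =
      insert 0 (Finset.univ.filter (fun i => 0 < i)) := by
    ext i
    simp only [Finset.mem_filter, Finset.mem_univ, true_and, Finset.mem_insert, true_iff]
    exact (Fin.zero_le i).eq_or_lt.imp Eq.symm id
  conv_rhs => rw [this]
  rw [Finset.sum_insert (by simp), add_comm, colStart]

lemma rowStart_mono {i j : Fin (n + 1)} (h : i ≤ j) : rowStart b i ≤ rowStart b j :=
  Finset.sum_le_sum_of_subset fun x hx => by
    simp only [Finset.mem_filter, Finset.mem_univ, true_and] at hx ⊢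
    exact hx.trans_le h

lemma colStart_anti {i j : Fin (n + 1)} (h : i ≤ j) : colStart b j ≤ colStart b i :=
  Finset.sum_le_sum_of_subset fun x hx => by
    simp only [Finset.mem_filter, Finset.mem_univ, true_and] at hx ⊢
    exact h.trans_lt hx

lemma rowStart_add_le {i j : Fin (n + 1)} (h : i < j) :
    rowStart b i + b i ≤ rowStart b j := by
  obtain ⟨i, rfl⟩ := Fin.exists_castSucc_eq.2 (h.trans_le (Fin.le_last j)).ne
  rw [← rowStart_succ]
  exact rowStart_mono b (by simpa [Fin.le_def, Fin.lt_def, Nat.succ_le_iff] using h)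

lemma colStart_add_le {i j : Fin (n + 1)} (h : i < j) :
    colStart b j + b j ≤ colStart b i := by
  obtain ⟨j, rfl⟩ := Fin.exists_succ_eq.2 ((Fin.zero_le i).trans_lt h).ne'
  rw [← colStart_castSucc]
  exact colStart_anti b (by simpa [Fin.le_def, Fin.lt_def, Nat.lt_succ_iff] using h)

lemma rowStart_add_le_sum (j : Fin (n + 1)) : rowStart b j + b j ≤ ∑ j, b j := by
  rcases (Fin.le_last j).eq_or_lt with rfl | h
  · exact (rowStart_last b).le
  · exact (rowStart_add_le b h).trans ((Nat.le_add_right _ _).trans (rowStart_last b).le)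

lemma colStart_add_le_sum (j : Fin (n + 1)) : colStart b j + b j ≤ ∑ j, b j := by
  rcases (Fin.zero_le j).eq_or_lt with rfl | h
  · exact (colStart_zero b).le
  · exact (colStart_add_le b h).trans ((Nat.le_add_right _ _).trans (colStart_zero b).le)

lemma exists_inBlockRow {x : ℕ} (hx : x < ∑ j, b j) : ∃ j, InBlockRow b j x := by
  by_contra hc
  have : ∀ j, rowStart b j ≤ x := by
    intro j
    induction j using Fin.induction with
    | zero => rw [rowStart_zero]; omega
    | succ j ih =>
      by_contra h
      rw [rowStart_succ] at h
      exact hc ⟨j.castSucc, ih, by omega⟩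
  exact hc ⟨Fin.last n, this _, by rw [rowStart_last]; exact hx⟩

lemma exists_inBlockCol {y : ℕ} (hy : y < ∑ j, b j) : ∃ i, InBlockCol b i y := by
  by_contra hc
  have : ∀ j, colStart b j ≤ y := by
    intro j
    induction j using Fin.reverseInduction with
    | last => rw [colStart_last]; omega
    | cast j ih =>
      by_contra h
      rw [colStart_castSucc] at h
      exact hc ⟨j.succ, ih, by omega⟩
  exact hc ⟨0, this _, by rw [colStart_zero]; exact hy⟩

variable {b}

lemma InBlockRow.lt_sum {j : Fin (n + 1)} {x : ℕ} (h : InBlockRow b j x) : x < ∑ j, b j :=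
  h.2.trans_le (rowStart_add_le_sum b j)

lemma InBlockCol.lt_sum {i : Fin (n + 1)} {y : ℕ} (h : InBlockCol b i y) : y < ∑ j, b j :=
  h.2.trans_le (colStart_add_le_sum b i)

lemma InBlockRow.le_iff {j q : Fin (n + 1)} {x : ℕ} (h : InBlockRow b q x) :
    rowStart b j ≤ x ↔ j ≤ q := by
  refine ⟨fun hj => ?_, fun hj => (rowStart_mono b hj).trans h.1⟩
  by_contra hc
  have := rowStart_add_le b (not_le.1 hc)
  have := h.2
  omega

lemma InBlockCol.le_iff {i p : Fin (n + 1)} {y : ℕ} (h : InBlockCol b p y) :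
    colStart b i ≤ y ↔ p ≤ i := by
  refine ⟨fun hj => ?_, fun hj => (colStart_anti b hj).trans h.1⟩
  by_contra hc
  have := colStart_add_le b (not_le.1 hc)
  have := h.2
  omega

lemma InBlockRow.unique {j q : Fin (n + 1)} {x : ℕ} (h : InBlockRow b j x)
    (h' : InBlockRow b q x) : j = q :=
  le_antisymm (h'.le_iff.1 h.1) (h.le_iff.1 h'.1)

/-! ### The Demazure product of an assembled pipe dream -/

lemma mem_assemble {Ps : ∀ j : Fin n, PipeDream (b j.castSucc) (b j.succ)}
    {x y : Fin (∑ j, b j)} :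
    (x, y) ∈ assemble b Ps ↔
      (∃ i j : Fin (n + 1), (j : ℕ) + 2 ≤ (i : ℕ) ∧ InBlockRow b j x ∧ InBlockCol b i y) ∨
      (∃ (j : Fin n) (p : Fin (b j.castSucc)) (q : Fin (b j.succ)), (p, q) ∈ Ps j ∧
        (x : ℕ) = rowStart b j.castSucc + p ∧ (y : ℕ) = colStart b j.succ + q) := by
  classical
  rw [assemble, Finset.mem_filter]
  simp

/-- In block row `j` of the assembled pipe dream, the columns to the left of the block
superantidiagonal are filled with crosses, and the crosses to the right of them are those
of `P_{j+1}`. -/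
lemma assemble_cols (Ps : ∀ j : Fin n, PipeDream (b j.castSucc) (b j.succ)) (j : Fin n) {t : ℕ}
    (ht : t < b j.castSucc) :
    (assemble b Ps).cols (rowStart b j.castSucc + t) =
      ((Ps j).cols t).map (colStart b j.succ + ·) ++ (List.range (colStart b j.succ)).reverse := by
  classical
  set c := colStart b j.succ with hc
  have hrow : InBlockRow b j.castSucc (rowStart b j.castSucc + t) := ⟨by omega, by omega⟩
  have hle := colStart_add_le_sum b j.succ
  have hsum : ∃ e, ∑ j, b j = (c + b j.succ) + e := ⟨∑ j, b j - (c + b j.succ), by omega⟩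
  obtain ⟨e, he⟩ := hsum
  have mem : ∀ y, (∃ (hx : rowStart b j.castSucc + t < ∑ j, b j) (hy : y < ∑ j, b j),
      ((⟨_, hx⟩, ⟨y, hy⟩) : Fin _ × Fin _) ∈ assemble b Ps) ↔
      y < c ∨ ∃ (hp : t < b j.castSucc) (q : ℕ) (hq : q < b j.succ), y = c + q ∧
        ((⟨t, hp⟩, ⟨q, hq⟩) : Fin _ × Fin _) ∈ Ps j := by
    intro y
    constructor
    · rintro ⟨hx, hy, h⟩
      rcases mem_assemble.1 h with ⟨i, j', hij, hj', hi⟩ | ⟨j', p, q, hpq, h1, h2⟩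
      · left
        obtain rfl := hrow.unique hj'
        refine hi.2.trans_le (colStart_add_le b ?_)
        rw [Fin.lt_def]
        simp only [Fin.val_castSucc] at hij
        simp only [Fin.val_succ]
        omega
      · right
        simp only at h1 h2
        have hj' : InBlockRow b j'.castSucc (rowStart b j.castSucc + t) :=
          ⟨by omega, by omega⟩
        obtain rfl : j = j' := Fin.castSucc_injective _ (hrow.unique hj')
        have hp : t = p := by omega
        subst hp
        exact ⟨p.2, q, q.2, h2, hpq⟩
    · rintro (h | ⟨hp, q, hq, rfl, hpq⟩)
      · refine ⟨hrow.lt_sum, by omega, mem_assemble.2 (Or.inl ?_)⟩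
        obtain ⟨i, hi⟩ := exists_inBlockCol b (y := y) (by omega)
        refine ⟨i, j.castSucc, ?_, hrow, hi⟩
        by_contra hij
        have : i ≤ j.succ := by
          rw [Fin.le_def]
          simp only [Fin.val_castSucc] at hij
          simp only [Fin.val_succ]
          omega
        have := hi.le_iff.2 this
        omega
      · exact ⟨hrow.lt_sum, by omega, mem_assemble.2 (Or.inr ⟨j, ⟨t, hp⟩, ⟨q, hq⟩, hpq, rfl, rfl⟩)⟩
  rw [PipeDream.cols]
  simp only [mem]
  rw [he, List.range_add, List.range_add, List.reverse_append, List.reverse_append,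
    List.filter_append, List.filter_append]
  rw [List.filter_eq_nil_iff.2 ?h1, List.nil_append, List.filter_eq_self (l := (List.range c).reverse).2 ?h2]
  · congr 1
    rw [← List.map_reverse, List.filter_map, PipeDream.cols]
    congr 1
    refine List.filter_congr fun y _ => ?_
    simp only [Function.comp_apply, decide_eq_decide]
    constructor
    · rintro (h | ⟨hp, q, hq, h, hm⟩)
      · omega
      · obtain rfl : y = q := by omega
        exact ⟨hp, hq, hm⟩
    · rintro ⟨hp, hq, hm⟩
      exact Or.inr ⟨hp, y, hq, rfl, hm⟩
  · intro y hy
    simp only [List.mem_reverse, List.mem_range] at hy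
    simp [hy]
  · intro y hy
    simp only [List.mem_reverse, List.mem_map] at hy
    obtain ⟨y, -, rfl⟩ := hy
    rw [decide_eq_true_eq]
    rintro (h | ⟨_, q, hq, h, -⟩) <;> omega

lemma assemble_cols_eq_nil (Ps : ∀ j : Fin n, PipeDream (b j.castSucc) (b j.succ)) {x : ℕ}
    (hx : rowStart b (Fin.last n) ≤ x) : (assemble b Ps).cols x = [] := by
  simp only [PipeDream.cols, List.filter_eq_nil_iff, decide_eq_true_eq, not_exists]
  intro y _ hx' hy' h
  rcases mem_assemble.1 h with ⟨i, j, hij, hj, hi⟩ | ⟨j, p, q, hpq, h1, h2⟩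
  · have := Fin.le_def.1 (hj.le_iff.1 hx)
    have := i.2
    simp only [Fin.val_last] at *
    omega
  · simp only at h1
    have h3 : InBlockRow b j.castSucc x := ⟨by omega, by omega⟩
    exact absurd (h3.le_iff.1 hx) (Fin.castSucc_lt_last j).not_ge

lemma coe_demazure_assemble (Ps : ∀ j : Fin n, PipeDream (b j.castSucc) (b j.succ)) :
    ⇑(assemble b Ps).demazure = headSeq id (assemble b Ps).cols := by
  rw [PipeDream.coe_demazure, PipeDream.cols_sortWord]

/-- The effect of block row `j` of the assembled pipe dream.  If `0, …, colStart b j - 1, E` is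
the sequence in front of it, then `P_{j+1}` acts on the columns of block column `j + 1`
followed by `E`, and as many entries as there are rows are split off the result. -/
lemma assemble_blockRow (Ps : ∀ j : Fin n, PipeDream (b j.castSucc) (b j.succ)) (j : Fin n)
    {E : ℕ → ℕ} (hE : ∀ i, colStart b j.castSucc ≤ E i)
    (hT : tailSeq id (assemble b Ps).cols (rowStart b j.castSucc) =
      prepend (colStart b j.castSucc) id E) :
    (∀ t < b j.castSucc, (assemble b Ps).demazure (rowStart b j.castSucc + t) =
      sortWord (prepend (b j.succ) (colStart b j.succ + ·) E) (Ps j).word t) ∧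
    tailSeq id (assemble b Ps).cols (rowStart b j.succ) = prepend (colStart b j.succ) id
      (fun i => sortWord (prepend (b j.succ) (colStart b j.succ + ·) E) (Ps j).word
        (b j.castSucc + i)) := by
  set A := prepend (b j.succ) (colStart b j.succ + ·) E with hA
  have hcol := colStart_castSucc b j
  have hT' : tailSeq id (assemble b Ps).cols (rowStart b j.castSucc) =
      prepend (colStart b j.succ) id A := by
    rw [hT]
    funext i
    simp only [prepend, hA, hcol, id]
    split_ifs
    all_goals first | omega | skip
    congr 1
    omega
  have hA' : ∀ i, colStart b j.succ ≤ A i := by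
    intro i
    simp only [hA, prepend]
    split_ifs
    · omega
    · have := hE (i - b j.succ)
      omega
  obtain ⟨h1, h2⟩ := tailSeq_prepend (Z := (Ps j).cols) (k := b j.castSucc) hT' hA'
    (cols := fun t => (assemble b Ps).cols (rowStart b j.castSucc + t))
    fun t ht => assemble_cols Ps j ht
  constructor
  · intro t ht
    rw [coe_demazure_assemble, headSeq_add, h2 t ht, PipeDream.cols_sortWord]
  · rw [rowStart_succ, tailSeq_add, h1 _ le_rfl]
    congr 1
    funext i
    exact PipeDream.tailSeq_cols _ _ _

end Blocks

/-! ### Enlarging all blocks by `m` -/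

/-- The permutation `1_m ⊕ v`, which fixes `0, …, m - 1` and acts as `v` on the numbers after
them. -/
def shiftPerm (m : ℕ) (v : Equiv.Perm ℕ) : Equiv.Perm ℕ where
  toFun := prepend m id fun x => m + v x
  invFun := prepend m id fun x => m + v.symm x
  left_inv := by
    intro x
    rcases lt_or_ge x m with h | h
    · simp [prepend, h]
    · obtain ⟨y, rfl⟩ := Nat.exists_eq_add_of_le h
      simp
  right_inv := by
    intro x
    rcases lt_or_ge x m with h | h
    · simp [prepend, h]
    · obtain ⟨y, rfl⟩ := Nat.exists_eq_add_of_le h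
      simp

lemma coe_shiftPerm (m : ℕ) (v : Equiv.Perm ℕ) :
    ⇑(shiftPerm m v) = prepend m id fun x => m + v x := rfl

lemma shiftPerm_of_lt {m x : ℕ} (v : Equiv.Perm ℕ) (h : x < m) : shiftPerm m v x = x := by
  rw [coe_shiftPerm, prepend_of_lt _ _ h, id]

@[simp] lemma shiftPerm_add (m : ℕ) (v : Equiv.Perm ℕ) (x : ℕ) :
    shiftPerm m v (m + x) = m + v x := by
  rw [coe_shiftPerm, prepend_add]

lemma sortWord_id_map_add (m : ℕ) (Q : List ℕ) :
    sortWord id (Q.map (m + ·)) = prepend m id fun x => m + sortWord id Q x := by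
  have h : (id : ℕ → ℕ) = prepend m id ((m + ·) ∘ id) := by
    funext x
    simp only [prepend, id, Function.comp_apply]
    split_ifs <;> omega
  conv_lhs => rw [h]
  rw [sortWord_prepend, sortWord_strictMono_comp fun x y hxy => Nat.add_lt_add_left hxy m]
  rfl

lemma prepend_injective {c : ℕ} {f A : ℕ → ℕ} (hf : f.Injective) (hA : A.Injective)
    (h : ∀ i < c, ∀ k, f i < A k) : (prepend c f A).Injective := by
  intro x y hxy
  unfold prepend at hxy
  split_ifs at hxy with hx hy hy
  · exact hf hxy
  · exact absurd hxy (h _ hx _).ne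
  · exact absurd hxy (h _ hy _).ne'
  · have := hA hxy
    omega

/-- The strictly monotone map that makes room for `m` new numbers in front of `s j`,
for every `j`. -/
def insertShift (m : ℕ) {n : ℕ} (s : Fin n → ℕ) (x : ℕ) : ℕ :=
  x + m * (Finset.univ.filter fun j => s j ≤ x).card

lemma insertShift_strictMono (m : ℕ) {n : ℕ} (s : Fin n → ℕ) : StrictMono (insertShift m s) := by
  intro x y hxy
  refine Nat.add_lt_add_of_lt_of_le hxy (Nat.mul_le_mul_left m (Finset.card_le_card fun j hj => ?_))
  simp only [Finset.mem_filter, Finset.mem_univ, true_and] at hj ⊢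
  omega

lemma card_filter_val_lt {n i : ℕ} (h : i ≤ n) :
    (Finset.univ.filter fun k : Fin n => (k : ℕ) < i).card = i := by
  rw [← Finset.card_map Fin.valEmbedding]
  conv_rhs => rw [← Finset.card_range i]
  congr 1
  ext x
  simp only [Finset.mem_map, Finset.mem_filter, Finset.mem_univ, true_and,
    Fin.valEmbedding_apply, Finset.mem_range]
  constructor
  · rintro ⟨k, hk, rfl⟩
    exact hk
  · intro hx
    exact ⟨⟨x, by omega⟩, hx, rfl⟩

lemma card_filter_le_val {n i : ℕ} (h : i ≤ n) :
    (Finset.univ.filter fun k : Fin n => i ≤ (k : ℕ)).card = n - i := by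
  have h1 := Finset.card_filter_add_card_filter_not (s := (Finset.univ : Finset (Fin n)))
    (fun k : Fin n => (k : ℕ) < i)
  rw [card_filter_val_lt h, Finset.card_univ, Fintype.card_fin] at h1
  simp only [not_lt] at h1
  omega

section Blocks

variable {n : ℕ} (m : ℕ) (b : Fin (n + 1) → ℕ)

/-- The embedding of the rows of the grid into the rows of the enlarged grid, in which every
block row but the last one has `m` new rows at its top. -/
def rowShift : ℕ → ℕ := insertShift m fun j : Fin n => rowStart b j.castSucc

/-- The embedding of the columns of the grid into the columns of the enlarged grid, in which
every block column but the rightmost one has `m` new columns at its left. -/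
def colShift : ℕ → ℕ := insertShift m fun j : Fin n => colStart b j.succ

lemma rowShift_strictMono : StrictMono (rowShift m b) := insertShift_strictMono _ _

lemma colShift_strictMono : StrictMono (colShift m b) := insertShift_strictMono _ _

lemma rowStart_enlarge (j : Fin (n + 1)) :
    rowStart (fun j => m + b j) j = rowStart b j + m * j := by
  induction j using Fin.induction with
  | zero => simp [rowStart_zero]
  | succ j ih =>
    rw [rowStart_succ, rowStart_succ, ih, Fin.val_succ, Fin.val_castSucc]
    ring

lemma colStart_enlarge (j : Fin (n + 1)) :
    colStart (fun j => m + b j) j = colStart b j + m * (n - j) := by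
  induction j using Fin.reverseInduction with
  | last => simp [colStart_last]
  | cast j ih =>
    rw [colStart_castSucc, colStart_castSucc, ih, Fin.val_succ, Fin.val_castSucc]
    have : n - (j : ℕ) = (n - (j + 1)) + 1 := by omega
    rw [this]
    ring

lemma sum_enlarge : ∑ j, (m + b j) = ∑ j, b j + m * n + m := by
  rw [Finset.sum_add_distrib, Finset.sum_const, Finset.card_univ, Fintype.card_fin, smul_eq_mul]
  ring

variable {b}

lemma le_card_rowStart_le {i : Fin (n + 1)} {x : ℕ} (h : rowStart b i ≤ x) :
    (i : ℕ) ≤ (Finset.univ.filter fun j : Fin n => rowStart b j.castSucc ≤ x).card := by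
  rw [← card_filter_val_lt (Nat.lt_succ_iff.1 i.2)]
  refine Finset.card_le_card fun k hk => ?_
  simp only [Finset.mem_filter, Finset.mem_univ, true_and] at hk ⊢
  exact (rowStart_mono b (Fin.le_def.2 (by simpa using hk.le))).trans h

lemma card_rowStart_le_le {i : Fin (n + 1)} {x : ℕ} (h : x < rowStart b i) :
    (Finset.univ.filter fun j : Fin n => rowStart b j.castSucc ≤ x).card ≤ i := by
  rw [← card_filter_val_lt (Nat.lt_succ_iff.1 i.2)]
  refine Finset.card_le_card fun k hk => ?_
  simp only [Finset.mem_filter, Finset.mem_univ, true_and] at hk ⊢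
  by_contra hc
  have := rowStart_mono b (i := i) (j := k.castSucc) (Fin.le_def.2 (by simpa using hc))
  omega

lemma le_card_colStart_le {i : Fin (n + 1)} {y : ℕ} (h : colStart b i ≤ y) :
    n - (i : ℕ) ≤ (Finset.univ.filter fun j : Fin n => colStart b j.succ ≤ y).card := by
  rw [← card_filter_le_val (Nat.lt_succ_iff.1 i.2)]
  refine Finset.card_le_card fun k hk => ?_
  simp only [Finset.mem_filter, Finset.mem_univ, true_and] at hk ⊢
  refine (colStart_anti b (Fin.le_def.2 ?_)).trans h
  simp only [Fin.val_succ]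
  omega

lemma card_colStart_le_le {i : Fin (n + 1)} {y : ℕ} (h : y < colStart b i) :
    (Finset.univ.filter fun j : Fin n => colStart b j.succ ≤ y).card ≤ n - (i : ℕ) := by
  rw [← card_filter_le_val (Nat.lt_succ_iff.1 i.2)]
  refine Finset.card_le_card fun k hk => ?_
  simp only [Finset.mem_filter, Finset.mem_univ, true_and] at hk ⊢
  by_contra hc
  have := colStart_anti b (i := k.succ) (j := i) (Fin.le_def.2 (by simp only [Fin.val_succ]; omega))
  omega

lemma succ_le_card_rowStart_le {j : Fin n} {x : ℕ} (h : rowStart b j.castSucc ≤ x) :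
    (j : ℕ) + 1 ≤ (Finset.univ.filter fun k : Fin n => rowStart b k.castSucc ≤ x).card := by
  rw [← card_filter_val_lt (show (j : ℕ) + 1 ≤ n from j.2)]
  refine Finset.card_le_card fun k hk => ?_
  simp only [Finset.mem_filter, Finset.mem_univ, true_and] at hk ⊢
  exact (rowStart_mono b (Fin.le_def.2 (by simp; omega))).trans h

lemma sub_le_card_colStart_le {j : Fin n} {y : ℕ} (h : colStart b j.succ ≤ y) :
    n - (j : ℕ) ≤ (Finset.univ.filter fun k : Fin n => colStart b k.succ ≤ y).card := by
  rw [← card_filter_le_val j.2.le]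
  refine Finset.card_le_card fun k hk => ?_
  simp only [Finset.mem_filter, Finset.mem_univ, true_and] at hk ⊢
  exact (colStart_anti b (Fin.le_def.2 (by simp; omega))).trans h

lemma rowStart_add_le_rowShift {j : Fin n} {x : ℕ} (h : rowStart b j.castSucc ≤ x) :
    rowStart (fun j => m + b j) j.castSucc + m ≤ rowShift m b x := by
  have := Nat.mul_le_mul_left m (succ_le_card_rowStart_le h)
  rw [mul_add, mul_one] at this
  rw [rowStart_enlarge, rowShift, insertShift, Fin.val_castSucc]
  omega

lemma colStart_add_le_colShift {j : Fin n} {y : ℕ} (h : colStart b j.succ ≤ y) :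
    colStart (fun j => m + b j) j.succ + m ≤ colShift m b y := by
  have := Nat.mul_le_mul_left m (sub_le_card_colStart_le h)
  rw [show n - (j : ℕ) = (n - (j + 1)) + 1 by omega, mul_add, mul_one] at this
  rw [colStart_enlarge, colShift, insertShift, Fin.val_succ]
  omega

lemma rowStart_le_rowShift_iff (i : Fin (n + 1)) (x : ℕ) :
    rowStart (fun j => m + b j) i ≤ rowShift m b x ↔ rowStart b i ≤ x := by
  rw [rowStart_enlarge, rowShift, insertShift]
  constructor
  · intro h
    by_contra hc
    have := Nat.mul_le_mul_left m (card_rowStart_le_le (not_le.1 hc))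
    omega
  · intro h
    exact Nat.add_le_add h (Nat.mul_le_mul_left m (le_card_rowStart_le h))

lemma colStart_le_colShift_iff (i : Fin (n + 1)) (y : ℕ) :
    colStart (fun j => m + b j) i ≤ colShift m b y ↔ colStart b i ≤ y := by
  rw [colStart_enlarge, colShift, insertShift]
  constructor
  · intro h
    by_contra hc
    have := Nat.mul_le_mul_left m (card_colStart_le_le (not_le.1 hc))
    omega
  · intro h
    exact Nat.add_le_add h (Nat.mul_le_mul_left m (le_card_colStart_le h))

lemma rowShift_last (x : ℕ) : rowShift m b (rowStart b (Fin.last n) + x) =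
    rowStart (fun j => m + b j) (Fin.last n) + x := by
  have h := le_card_rowStart_le (b := b) (i := Fin.last n) (Nat.le_add_right _ x)
  have h' := (Finset.card_filter_le (Finset.univ : Finset (Fin n))
    fun j : Fin n => rowStart b j.castSucc ≤ rowStart b (Fin.last n) + x)
  rw [Finset.card_univ, Fintype.card_fin] at h'
  rw [Fin.val_last] at h
  rw [rowStart_enlarge, rowShift, insertShift, le_antisymm h' h, Fin.val_last]
  ring

lemma colShift_zero (y : ℕ) : colShift m b (colStart b 0 + y) =
    colStart (fun j => m + b j) 0 + y := by
  have h := le_card_colStart_le (b := b) (i := 0) (Nat.le_add_right _ y)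
  have h' := (Finset.card_filter_le (Finset.univ : Finset (Fin n))
    fun j : Fin n => colStart b j.succ ≤ colStart b 0 + y)
  rw [Finset.card_univ, Fintype.card_fin] at h'
  rw [Fin.val_zero, Nat.sub_zero] at h
  rw [colStart_enlarge, colShift, insertShift, le_antisymm h' h, Fin.val_zero, Nat.sub_zero]
  ring

lemma rowShift_castSucc (j : Fin n) {x : ℕ} (hx : x < b j.castSucc) :
    rowShift m b (rowStart b j.castSucc + x) =
      rowStart (fun j => m + b j) j.castSucc + (m + x) := by
  have h' := card_rowStart_le_le (b := b) (i := j.succ) (x := rowStart b j.castSucc + x)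
    (by rw [rowStart_succ]; omega)
  have h := succ_le_card_rowStart_le (Nat.le_add_right (rowStart b j.castSucc) x)
  rw [Fin.val_succ] at h'
  rw [rowStart_enlarge, rowShift, insertShift, le_antisymm h' h, Fin.val_castSucc]
  ring

lemma colShift_succ (j : Fin n) {y : ℕ} (hy : y < b j.succ) :
    colShift m b (colStart b j.succ + y) = colStart (fun j => m + b j) j.succ + (m + y) := by
  have h' := card_colStart_le_le (b := b) (i := j.castSucc) (y := colStart b j.succ + y)
    (by rw [colStart_castSucc]; omega)
  have h := sub_le_card_colStart_le (Nat.le_add_right (colStart b j.succ) y)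
  rw [Fin.val_castSucc] at h'
  rw [colStart_enlarge, colShift, insertShift, le_antisymm h' h, Fin.val_succ]
  have : n - (j : ℕ) = (n - (j + 1)) + 1 := by omega
  rw [this]
  ring

variable {m} {Ps : ∀ j : Fin n, PipeDream (b j.castSucc) (b j.succ)}
  {Ps' : ∀ j : Fin n, PipeDream (m + b j.castSucc) (m + b j.succ)}

/-- The action of `P'_{j+1}` in the enlarged assembled pipe dream, if its Demazure product is
that of `P_{j+1}` shifted by `m`: the `m` new columns stay in front. -/
lemma sortWord_enlarge {j : Fin n} (hP : (Ps' j).demazure = shiftPerm m (Ps j).demazure)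
    {E : ℕ → ℕ} (hEi : E.Injective) (hE : ∀ i, colStart b j.castSucc ≤ E i) :
    sortWord (prepend (m + b j.succ) (colStart (fun j => m + b j) j.succ + ·)
        (colShift m b ∘ E)) (Ps' j).word =
      prepend m (colStart (fun j => m + b j) j.succ + ·)
        (colShift m b ∘ sortWord (prepend (b j.succ) (colStart b j.succ + ·) E) (Ps j).word) := by
  have hword : sortWord id (Ps' j).word = sortWord id ((Ps j).word.map (m + ·)) := by
    rw [sortWord_id_map_add, ← PipeDream.coe_demazure, hP, coe_shiftPerm, PipeDream.coe_demazure]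
  have hinj : (prepend (m + b j.succ) (colStart (fun j => m + b j) j.succ + ·)
      (colShift m b ∘ E)).Injective := by
    refine prepend_injective (add_right_injective _)
      ((colShift_strictMono m b).injective.comp hEi) fun i hi k => ?_
    have := (colStart_le_colShift_iff m j.castSucc (E k)).2 (hE k)
    rw [colStart_castSucc] at this
    rw [Function.comp_apply]
    omega
  have hfun : prepend (m + b j.succ) (colStart (fun j => m + b j) j.succ + ·) (colShift m b ∘ E) =
      prepend m (colStart (fun j => m + b j) j.succ + ·)
        (colShift m b ∘ prepend (b j.succ) (colStart b j.succ + ·) E) := by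
    funext i
    rcases lt_or_ge i m with hi | hi
    · rw [prepend_of_lt _ _ hi, prepend_of_lt _ _ (by omega)]
    · obtain ⟨i, rfl⟩ := Nat.exists_eq_add_of_le hi
      rw [prepend_add, Function.comp_apply]
      rcases lt_or_ge i (b j.succ) with hi | hi
      · rw [prepend_of_lt _ _ hi, prepend_of_lt _ _ (by omega), colShift_succ m j hi]
      · obtain ⟨i, rfl⟩ := Nat.exists_eq_add_of_le hi
        rw [← add_assoc, prepend_add, prepend_add, Function.comp_apply]
  rw [sortWord_congr hinj hword, hfun, sortWord_prepend,
    sortWord_strictMono_comp (colShift_strictMono m b)]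

/-- In front of block row `j`, the sequence `E` of `assemble_blockRow` for the enlarged pipe dream
is the one for the original pipe dream, with its entries renumbered by `colShift`. -/
lemma exists_tailSeq_eq (hP : ∀ j, (Ps' j).demazure = shiftPerm m (Ps j).demazure)
    (j : Fin (n + 1)) : ∃ E : ℕ → ℕ, E.Injective ∧ (∀ i, colStart b j ≤ E i) ∧
      tailSeq id (assemble b Ps).cols (rowStart b j) = prepend (colStart b j) id E ∧
      tailSeq id (assemble (fun j => m + b j) Ps').cols (rowStart (fun j => m + b j) j) =
        prepend (colStart (fun j => m + b j) j) id (colShift m b ∘ E) := by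
  induction j using Fin.induction with
  | zero =>
    refine ⟨(colStart b 0 + ·), add_right_injective _, fun i => Nat.le_add_right _ _, ?_, ?_⟩
    · rw [rowStart_zero]
      funext i
      simp only [tailSeq, prepend, id]
      split_ifs <;> omega
    · rw [rowStart_zero]
      funext i
      simp only [tailSeq, prepend, id, Function.comp_apply, colShift_zero]
      split_ifs <;> omega
  | succ j ih =>
    obtain ⟨E, hEi, hE, h1, h2⟩ := ih
    have hE' : ∀ i, colStart (fun j => m + b j) j.castSucc ≤ (colShift m b ∘ E) i := fun i =>
      (colStart_le_colShift_iff m j.castSucc (E i)).2 (hE i)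
    have hA : (prepend (b j.succ) (colStart b j.succ + ·) E).Injective := by
      refine prepend_injective (add_right_injective _) hEi fun i hi k => ?_
      have := hE k
      rw [colStart_castSucc] at this
      omega
    refine ⟨_, (sortWord_injective hA (Ps j).word).comp (add_right_injective (b j.castSucc)), ?_,
      (assemble_blockRow Ps j hE h1).2, ?_⟩
    · intro i
      refine sortWord_forall (p := fun y => colStart b j.succ ≤ y) (fun x => ?_) _ _
      unfold prepend
      split_ifs
      · exact Nat.le_add_right _ _
      · exact (colStart_anti b (Fin.castSucc_lt_succ).le).trans (hE _)
    · rw [(assemble_blockRow (b := fun j => m + b j) Ps' j hE' h2).2,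
        sortWord_enlarge (hP j) hEi hE]
      congr 1
      funext i
      rw [add_assoc, prepend_add]
      rfl

/-- The effect on the Demazure product of enlarging all blocks, in the rows of block row `j`. -/
lemma demazure_enlarge_castSucc (hP : ∀ j, (Ps' j).demazure = shiftPerm m (Ps j).demazure)
    (j : Fin n) :
    (∀ t < m, (assemble (fun j => m + b j) Ps').demazure
      (rowStart (fun j => m + b j) j.castSucc + t) = colStart (fun j => m + b j) j.succ + t) ∧
    ∀ t < b j.castSucc, (assemble (fun j => m + b j) Ps').demazure
      (rowStart (fun j => m + b j) j.castSucc + (m + t)) =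
        colShift m b ((assemble b Ps).demazure (rowStart b j.castSucc + t)) := by
  obtain ⟨E, hEi, hE, h1, h2⟩ := exists_tailSeq_eq hP j.castSucc
  have hE' : ∀ i, colStart (fun j => m + b j) j.castSucc ≤ (colShift m b ∘ E) i := fun i =>
    (colStart_le_colShift_iff m j.castSucc (E i)).2 (hE i)
  have h3 := (assemble_blockRow Ps j hE h1).1
  have h4 := (assemble_blockRow (b := fun j => m + b j) Ps' j hE' h2).1
  rw [sortWord_enlarge (hP j) hEi hE] at h4
  constructor
  · intro t ht
    rw [h4 t (by omega), prepend_of_lt _ _ ht]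
  · intro t ht
    rw [h4 (m + t) (by omega), prepend_add, h3 t ht, Function.comp_apply]

/-- The effect on the Demazure product of enlarging all blocks, in and after the last
block row. -/
lemma demazure_enlarge_last (hP : ∀ j, (Ps' j).demazure = shiftPerm m (Ps j).demazure) (x : ℕ) :
    (assemble (fun j => m + b j) Ps').demazure (rowStart (fun j => m + b j) (Fin.last n) + x) =
      colShift m b ((assemble b Ps).demazure (rowStart b (Fin.last n) + x)) := by
  obtain ⟨E, -, -, h1, h2⟩ := exists_tailSeq_eq hP (Fin.last n)
  rw [coe_demazure_assemble, coe_demazure_assemble,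
    headSeq_of_nil fun t => assemble_cols_eq_nil _ (Nat.le_add_right _ _),
    headSeq_of_nil fun t => assemble_cols_eq_nil _ (Nat.le_add_right _ _), h1, h2]
  simp [colStart_last, prepend]

end Blocks

/-! ### Minimal completions -/

lemma length_symm (v : Equiv.Perm ℕ) : length v.symm = length v := by
  have : {p : ℕ × ℕ | p.1 < p.2 ∧ v.symm p.2 < v.symm p.1} =
      (fun p : ℕ × ℕ => (v p.2, v p.1)) '' {p : ℕ × ℕ | p.1 < p.2 ∧ v p.2 < v p.1} := by
    ext ⟨x, y⟩
    simp only [Set.mem_ofPred_eq, Set.mem_image, Prod.exists, Prod.mk.injEq]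
    constructor
    · rintro ⟨h1, h2⟩
      exact ⟨v.symm y, v.symm x, ⟨h2, by simpa using h1⟩, by simp, by simp⟩
    · rintro ⟨a, c, ⟨h1, h2⟩, rfl, rfl⟩
      exact ⟨h2, by simpa using h1⟩
  rw [length, this, Set.ncard_image_of_injective, length]
  rintro ⟨a, c⟩ ⟨a', c'⟩ h
  simp only [Prod.mk.injEq, EmbeddingLike.apply_eq_iff_eq] at h
  rw [h.1, h.2]

lemma FinitelySupported.symm {v : Equiv.Perm ℕ} (hv : FinitelySupported v) :
    FinitelySupported v.symm :=
  hv.subset fun x hx h => hx (by rw [Equiv.symm_apply_eq, h])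

lemma length_shiftPerm (m : ℕ) (v : Equiv.Perm ℕ) : length (shiftPerm m v) = length v := by
  have : {p : ℕ × ℕ | p.1 < p.2 ∧ shiftPerm m v p.2 < shiftPerm m v p.1} =
      Prod.map (m + ·) (m + ·) '' {p : ℕ × ℕ | p.1 < p.2 ∧ v p.2 < v p.1} := by
    ext ⟨x, y⟩
    simp only [Set.mem_ofPred_eq, Set.mem_image, Prod.exists, Prod.map_apply, Prod.mk.injEq]
    constructor
    · rintro ⟨h1, h2⟩
      rcases lt_or_ge x m with hx | hx
      · rw [shiftPerm_of_lt v hx] at h2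
        rcases lt_or_ge y m with hy | hy
        · rw [shiftPerm_of_lt v hy] at h2
          omega
        · obtain ⟨y, rfl⟩ := Nat.exists_eq_add_of_le hy
          rw [shiftPerm_add] at h2
          omega
      · obtain ⟨x, rfl⟩ := Nat.exists_eq_add_of_le hx
        obtain ⟨y, rfl⟩ := Nat.exists_eq_add_of_le (hx.trans h1.le)
        rw [shiftPerm_add, shiftPerm_add] at h2
        exact ⟨x, y, ⟨by omega, by omega⟩, rfl, rfl⟩
    · rintro ⟨a, c, ⟨h1, h2⟩, rfl, rfl⟩
      rw [shiftPerm_add, shiftPerm_add]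
      exact ⟨by omega, by omega⟩
  rw [length, this, Set.ncard_image_of_injective, length]
  exact (add_right_injective m).prodMap (add_right_injective m)

lemma finitelySupported_shiftPerm_iff {m : ℕ} {v : Equiv.Perm ℕ} :
    FinitelySupported (shiftPerm m v) ↔ FinitelySupported v := by
  have : {x | shiftPerm m v x ≠ x} = (m + ·) '' {x | v x ≠ x} := by
    ext x
    simp only [Set.mem_ofPred_eq, Set.mem_image]
    constructor
    · intro h
      rcases lt_or_ge x m with hx | hx
      · exact absurd (shiftPerm_of_lt v hx) h
      · obtain ⟨x, rfl⟩ := Nat.exists_eq_add_of_le hx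
        rw [shiftPerm_add] at h
        exact ⟨x, fun hc => h (by rw [hc]), rfl⟩
    · rintro ⟨y, hy, rfl⟩
      rw [shiftPerm_add]
      omega
  rw [FinitelySupported, this, Set.finite_image_iff (add_right_injective m).injOn,
    FinitelySupported]

lemma exists_eq_shiftPerm {m : ℕ} {u : Equiv.Perm ℕ} (h : ∀ x < m, u x = x) :
    ∃ v, u = shiftPerm m v := by
  have h1 : ∀ x, m ≤ x → m ≤ u x := by
    intro x hx
    by_contra hc
    have := u.injective (h (u x) (by omega))
    omega
  have h2 : ∀ x, m ≤ x → m ≤ u.symm x := by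
    intro x hx
    by_contra hc
    have := h (u.symm x) (by omega)
    rw [Equiv.apply_symm_apply] at this
    omega
  refine ⟨⟨fun x => u (m + x) - m, fun x => u.symm (m + x) - m, fun x => ?_, fun x => ?_⟩, ?_⟩
  · have := h1 (m + x) (by omega)
    simp [Nat.add_sub_cancel' this]
  · have := h2 (m + x) (by omega)
    simp [Nat.add_sub_cancel' this]
  · ext x
    rcases lt_or_ge x m with hx | hx
    · rw [h x hx, shiftPerm_of_lt _ hx]
    · obtain ⟨x, rfl⟩ := Nat.exists_eq_add_of_le hx
      rw [shiftPerm_add]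
      have := h1 (m + x) (by omega)
      simp only [Equiv.coe_fn_mk]
      omega

section PartialPerm

variable {k l m : ℕ}

lemma shiftPartialPerm_castAdd (w : PartialPerm k l) (i : Fin m) :
    shiftPartialPerm m w (Fin.castAdd k i) = some (Fin.castAdd l i) := by
  change PEquiv.toFun (shiftPartialPerm m w) _ = _
  simp only [shiftPartialPerm, Fin.addCases_left]

lemma shiftPartialPerm_natAdd (w : PartialPerm k l) (p : Fin k) :
    shiftPartialPerm m w (Fin.natAdd m p) = (w p).map (Fin.natAdd m) := by
  change PEquiv.toFun (shiftPartialPerm m w) _ = _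
  simp only [shiftPartialPerm, Fin.addCases_right]

lemma shiftPartialPerm_injective :
    Function.Injective (shiftPartialPerm m : PartialPerm k l → PartialPerm (m + k) (m + l)) := by
  intro w w' h
  ext1 p
  have := congrArg (fun u : PartialPerm (m + k) (m + l) => u (Fin.natAdd m p)) h
  simp only [shiftPartialPerm_natAdd] at this
  exact Option.map_injective (Fin.natAdd_injective _ _) this

lemma Completes.eq {w w' : PartialPerm k l} {v : Equiv.Perm ℕ} (h : Completes w v)
    (h' : Completes w' v) : w = w' := by
  ext p q
  exact (h.2 p q).symm.trans (h'.2 p q)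

lemma completes_shift_iff {w : PartialPerm k l} {v : Equiv.Perm ℕ} :
    Completes (shiftPartialPerm m w) (shiftPerm m v) ↔ Completes w v := by
  refine and_congr finitelySupported_shiftPerm_iff ⟨fun h p q => ?_, fun h p q => ?_⟩
  · have := h (Fin.natAdd m p) (Fin.natAdd m q)
    rw [shiftPartialPerm_natAdd, Fin.val_natAdd, Fin.val_natAdd, shiftPerm_add] at this
    simpa only [add_right_inj, Option.map_eq_some_iff, Fin.natAdd_inj, exists_eq_right] using this
  · induction p using Fin.addCases with
    | left i =>
      rw [shiftPartialPerm_castAdd, Fin.val_castAdd, shiftPerm_of_lt v i.2]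
      simp [Fin.ext_iff]
    | right p =>
      rw [shiftPartialPerm_natAdd, Fin.val_natAdd, shiftPerm_add]
      induction q using Fin.addCases with
      | left j =>
        simp only [Fin.val_castAdd, Option.map_eq_some_iff, Fin.ext_iff, Fin.val_natAdd]
        constructor
        · intro h
          have := j.2
          omega
        · rintro ⟨q, -, h⟩
          have := j.2
          omega
      | right q =>
        rw [Fin.val_natAdd, add_right_inj, h p q]
        simp only [Option.map_eq_some_iff, Fin.natAdd_inj, exists_eq_right]

lemma Completes.apply_of_lt {w : PartialPerm k l} {u : Equiv.Perm ℕ}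
    (hu : Completes (shiftPartialPerm m w) u) (x : ℕ) (hx : x < m) : u x = x := by
  simpa using (hu.2 (Fin.castAdd k ⟨x, hx⟩) (Fin.castAdd l ⟨x, hx⟩)).2
    (shiftPartialPerm_castAdd w ⟨x, hx⟩)

/-- The minimal completion of `m + w` is `1_m ⊕ v`, where `v` is that of `w`. -/
lemma isMinimalCompletion_shift_iff {w : PartialPerm k l} {v : Equiv.Perm ℕ} :
    IsMinimalCompletion (shiftPartialPerm m w) (shiftPerm m v) ↔ IsMinimalCompletion w v := by
  refine and_congr completes_shift_iff ⟨fun h u hu => ?_, fun h u hu => ?_⟩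
  · simpa only [length_shiftPerm] using h _ (completes_shift_iff.2 hu)
  · obtain ⟨u, rfl⟩ := exists_eq_shiftPerm (m := m) (u := u) hu.apply_of_lt
    simpa only [length_shiftPerm] using h _ (completes_shift_iff.1 hu)

/-- The upper-left `k × l` corner of a permutation. -/
def corner (k l : ℕ) (v : Equiv.Perm ℕ) : PartialPerm k l where
  toFun p := if h : v p < l then some ⟨v p, h⟩ else none
  invFun q := if h : v.symm q < k then some ⟨v.symm q, h⟩ else none
  inv p q := by
    simp only [Option.dite_none_right_eq_some, Option.some.injEq, Fin.ext_iff, exists_prop]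
    constructor
    · rintro ⟨-, h⟩
      rw [← h, Equiv.apply_symm_apply]
      exact ⟨by omega, rfl⟩
    · rintro ⟨-, h⟩
      rw [← h, Equiv.symm_apply_apply]
      exact ⟨by omega, rfl⟩

lemma completes_corner {v : Equiv.Perm ℕ} (hv : FinitelySupported v) :
    Completes (corner k l v) v := by
  refine ⟨hv, fun p q => ?_⟩
  change _ ↔ (if h : v p < l then some (⟨v p, h⟩ : Fin l) else none) = _
  simp only [Option.dite_none_right_eq_some, Option.some.injEq, Fin.ext_iff, exists_prop]
  constructor
  · intro h
    exact ⟨by omega, h⟩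
  · exact fun h => h.2

/-- A minimal completion has no descents at or after position `k`. -/
lemma IsMinimalCompletion.strictMono_add {w : PartialPerm k l} {v : Equiv.Perm ℕ}
    (h : IsMinimalCompletion w v) : StrictMono fun x => v (k + x) := by
  refine strictMono_nat_of_lt_succ fun x => ?_
  by_contra hc
  have hne : v (k + x) ≠ v (k + (x + 1)) := fun he => by
    have := v.injective he
    omega
  set u := v * simpleReflection (k + x) with hu
  have hc1 : Completes w u := by
    refine ⟨h.1.1.mul_simpleReflection _, fun p q => ?_⟩
    rw [← h.1.2 p q, hu, Equiv.Perm.mul_apply, simpleReflection,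
      Equiv.swap_apply_of_ne_of_ne (by omega) (by omega)]
  have h1 := h.2 u hc1
  have h2 : length (u * simpleReflection (k + x)) = length u + 1 :=
    length_mul_simpleReflection hc1.1 (by
      simp only [hu, Equiv.Perm.mul_apply, simpleReflection, Equiv.swap_apply_left,
        Equiv.swap_apply_right]
      rw [add_assoc]
      omega)
  rw [hu, mul_assoc, simpleReflection, Equiv.swap_mul_self, mul_one] at h2
  rw [hu, simpleReflection] at h1
  omega

lemma Completes.symm {w : PartialPerm k l} {v : Equiv.Perm ℕ} (h : Completes w v) :
    Completes w.symm v.symm := by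
  refine ⟨h.1.symm, fun p q => ?_⟩
  rw [← Option.mem_def, PEquiv.mem_iff_mem, Option.mem_def, ← h.2 q p, Equiv.symm_apply_eq,
    eq_comm]

lemma IsMinimalCompletion.symm {w : PartialPerm k l} {v : Equiv.Perm ℕ}
    (h : IsMinimalCompletion w v) : IsMinimalCompletion w.symm v.symm := by
  refine ⟨h.1.symm, fun u hu => ?_⟩
  rw [length_symm, ← length_symm u]
  have := hu.symm
  rw [PEquiv.symm_symm] at this
  exact h.2 _ this

/-- The pipe dream whose crosses in row `p` fill the first `c p` columns, where `c` is the
Lehmer code of `v`, has Demazure product `v`. -/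
lemma exists_demazure_eq {v : Equiv.Perm ℕ} (hv : StrictMono fun x => v (k + x))
    (hv' : StrictMono fun y => v.symm (l + y)) : ∃ P : PipeDream k l, P.demazure = v := by
  classical
  -- `e p` lists in increasing order the values of `v` at the positions `≥ p`.
  set e : ℕ → ℕ → ℕ := fun p => Nat.nth fun y => p ≤ v.symm y with he
  have hinf : ∀ p, (Set.ofPred fun y => p ≤ v.symm y).Infinite := fun p =>
    (Set.infinite_range_of_injective (v.injective.comp (add_right_injective p))).mono (by
      rintro _ ⟨x, rfl⟩
      simp)
  have hmono : ∀ p, StrictMono (e p) := fun p => Nat.nth_strictMono (hinf p)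
  have hrange : ∀ p, Set.range (e p) = {y | p ≤ v.symm y} := fun p =>
    Nat.range_nth_of_infinite (hinf p)
  set c : ℕ → ℕ := fun p => Nat.count (fun y => p ≤ v.symm y) (v p) with hc
  have hec : ∀ p, e p (c p) = v p := fun p => Nat.nth_count (by simp)
  have hcl : ∀ p < k, c p ≤ l := by
    intro p hp
    simp only [hc]
    rw [Nat.count_eq_card_filter_range]
    refine (Finset.card_le_card (t := Finset.range l) fun y hy => ?_).trans (Finset.card_range l).le
    simp only [Finset.mem_filter, Finset.mem_range] at hy ⊢
    by_contra hyl
    have := hv' (a := y - l) (b := v p - l) (by omega)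
    simp only at this
    rw [Nat.add_sub_cancel' (by omega), Nat.add_sub_cancel' (by omega),
      Equiv.symm_apply_apply] at this
    omega
  set P : PipeDream k l := Finset.univ.filter fun x => (x.2 : ℕ) < c x.1 with hP
  have hcols : ∀ p < k, P.cols p = (List.range (c p)).reverse := by
    intro p hp
    obtain ⟨d, hd⟩ := Nat.exists_eq_add_of_le (hcl p hp)
    have mem : ∀ y, (∃ (hx : p < k) (hy : y < l), (⟨p, hx⟩, ⟨y, hy⟩) ∈ P) ↔ y < c p := by
      intro y
      simp only [hP, Finset.mem_filter, Finset.mem_univ, true_and]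
      constructor
      · rintro ⟨-, -, h⟩
        exact h
      · exact fun h => ⟨hp, by omega, h⟩
    rw [PipeDream.cols]
    simp only [mem]
    rw [hd, List.range_add, List.reverse_append, List.filter_append,
      List.filter_eq_nil_iff.2 ?h1, List.nil_append,
      List.filter_eq_self (l := (List.range (c p)).reverse).2 ?h2]
    case h1 =>
      intro y hy
      simp only [List.mem_reverse, List.mem_map] at hy
      obtain ⟨y, -, rfl⟩ := hy
      simp
    case h2 =>
      intro y hy
      simpa using hy
  have hstep : ∀ p < k, tailSeq id P.cols p = e p → sortWord (tailSeq id P.cols p) (P.cols p) =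
      fun i => if i = 0 then v p else if i ≤ c p then e p (i - 1) else e p i := by
    intro p hp h
    rw [h, hcols p hp, sortWord_reverse_range fun t ht => hmono p ht, hec]
  have htail : ∀ p ≤ k, tailSeq id P.cols p = e p := by
    intro p
    induction p with
    | zero =>
      intro _
      simp only [he, Nat.zero_le]
      funext i
      exact (Nat.nth_true i).symm
    | succ p ih =>
      intro hp
      have h1 := hstep p (by omega) (ih (by omega))
      have h2 : tailSeq id P.cols (p + 1) =
          fun i => if i < c p then e p i else e p (i + 1) := by
        funext i
        change sortWord _ _ (i + 1) = _
        rw [h1]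
        simp
      rw [h2]
      refine (StrictMono.range_inj ?_ (hmono _)).1 ?_
      · intro i j hij
        simp only
        split_ifs
        all_goals first | omega | exact hmono p (by omega)
      · rw [hrange]
        ext y
        have hy := Set.ext_iff.1 (hrange p) y
        simp only [Set.mem_range, Set.mem_ofPred_eq] at hy ⊢
        have hne : ∀ i, i ≠ c p → v.symm (e p i) ≠ p := by
          intro i hi h
          rw [Equiv.symm_apply_eq, ← hec] at h
          exact hi ((hmono p).injective h)
        have hle : ∀ i, p ≤ v.symm (e p i) := fun i =>
          (Set.ext_iff.1 (hrange p) (e p i)).1 ⟨i, rfl⟩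
        constructor
        · rintro ⟨i, rfl⟩
          split_ifs with hi
          · exact lt_of_le_of_ne (hle _) (hne i (by omega)).symm
          · exact lt_of_le_of_ne (hle _) (hne (i + 1) (by omega)).symm
        · intro h
          obtain ⟨i, rfl⟩ := hy.2 (by omega)
          have hi : i ≠ c p := by
            rintro rfl
            rw [hec, Equiv.symm_apply_apply] at h
            omega
          rcases lt_or_gt_of_ne hi with hi | hi
          · exact ⟨i, if_pos hi⟩
          · refine ⟨i - 1, ?_⟩
            rw [if_neg (by omega), Nat.sub_add_cancel (by omega)]
  refine ⟨P, Equiv.coe_fn_injective ?_⟩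
  beta_reduce
  rw [PipeDream.coe_demazure, PipeDream.cols_sortWord]
  funext x
  rcases lt_or_ge x k with hx | hx
  · rw [headSeq, hstep x hx (htail x hx.le)]
    rfl
  · obtain ⟨x, rfl⟩ := Nat.exists_eq_add_of_le hx
    rw [headSeq_of_nil fun t => P.cols_eq_nil (by omega), htail k le_rfl]
    have : e k = fun x => v (k + x) := by
      refine (StrictMono.range_inj (hmono _) hv).1 ?_
      rw [hrange]
      ext y
      simp only [Set.mem_ofPred_eq, Set.mem_range]
      constructor
      · intro h
        exact ⟨v.symm y - k, by simp [Nat.add_sub_cancel' h]⟩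
      · rintro ⟨x, rfl⟩
        simp
    rw [this]

lemma IsMinimalCompletion.exists_demazure_eq {w : PartialPerm k l} {v : Equiv.Perm ℕ}
    (h : IsMinimalCompletion w v) : ∃ P : PipeDream k l, P.demazure = v :=
  LacingDiagrams.exists_demazure_eq h.strictMono_add h.symm.strictMono_add

end PartialPerm

/-! ### Zelevinsky permutations of enlarged block sizes -/

section Blocks

variable {n : ℕ} {b : Fin (n + 1) → ℕ}

lemma InBlockCol.unique {i p : Fin (n + 1)} {y : ℕ} (h : InBlockCol b i y)
    (h' : InBlockCol b p y) : i = p :=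
  le_antisymm (h.le_iff.1 h'.1) (h'.le_iff.1 h.1)

variable (b) in
lemma rowStart_add_colStart (j : Fin (n + 1)) :
    rowStart b j + b j + colStart b j = ∑ j, b j := by
  induction j using Fin.induction with
  | zero => rw [rowStart_zero, ← colStart_zero]; ring
  | succ j ih =>
    rw [← ih, rowStart_succ, colStart_castSucc]
    ring

lemma southeastRank_eq (v : Equiv.Perm ℕ) (i j : Fin (n + 1)) :
    southeastRank b v i j =
      {x | rowStart b j ≤ x ∧ x < ∑ j, b j ∧ colStart b i ≤ v x ∧ v x < ∑ j, b j}.ncard := by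
  rw [southeastRank]
  congr 1
  ext x
  constructor
  · rintro ⟨q, p, hq, hp, hx, hy⟩
    exact ⟨hx.le_iff.2 hq, hx.lt_sum, hy.le_iff.2 hp, hy.lt_sum⟩
  · rintro ⟨h1, h2, h3, h4⟩
    obtain ⟨q, hq⟩ := exists_inBlockRow b h2
    obtain ⟨p, hp⟩ := exists_inBlockCol b h4
    exact ⟨q, p, hq.le_iff.1 h1, hp.le_iff.1 h3, hq, hp⟩

lemma lt_of_fixes {v : Equiv.Perm ℕ} {d : ℕ} (h : ∀ x, d ≤ x → v x = x) {x : ℕ} (hx : x < d) :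
    v x < d := by
  by_contra hc
  have := v.injective (h (v x) (by omega))
  omega

/-- The nonzero entries in the southeast corner block of a Zelevinsky permutation are on the
diagonal of the grid, at its end. -/
lemma IsZelevinsky.fixes_of_le {v : Equiv.Perm ℕ} (hv : IsZelevinsky b v) {x : ℕ}
    (hx : ∑ j, b j ≤ x + southeastRank b v 0 (Fin.last n)) : v x = x := by
  have hC := colStart_zero b
  have hR := rowStart_last b
  rw [southeastRank_eq] at hx
  have key : ∀ x, ∑ j, b j ≤ x + {x | rowStart b (Fin.last n) ≤ x ∧ x < ∑ j, b j ∧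
      colStart b 0 ≤ v x ∧ v x < ∑ j, b j}.ncard → x < ∑ j, b j → colStart b 0 ≤ v x := by
    intro x hx hxd
    by_contra hc
    have hsub : {x | rowStart b (Fin.last n) ≤ x ∧ x < ∑ j, b j ∧
        colStart b 0 ≤ v x ∧ v x < ∑ j, b j} ⊆ Finset.Ioo x (∑ j, b j) := by
      rintro y ⟨h1, h2, h3, -⟩
      rw [Finset.coe_Ioo]
      refine ⟨?_, h2⟩
      by_contra hxy
      rcases (not_lt.1 hxy).eq_or_lt with rfl | hlt
      · exact hc h3
      · have := hv.blockRows (Fin.last n) y x ⟨h1, by omega⟩ ⟨by omega, by omega⟩ hlt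
        omega
    have := Set.ncard_le_ncard hsub (Finset.finite_toSet _)
    rw [Set.ncard_coe_finset, Nat.card_Ioo] at this
    omega
  obtain ⟨e, he⟩ : ∃ e, ∑ j, b j ≤ x + e := ⟨∑ j, b j, by omega⟩
  induction e using Nat.strong_induction_on generalizing x with
  | _ e ih =>
    rcases le_or_gt (∑ j, b j) x with hxd | hxd
    · exact hv.fixes x hxd
    · have hfix : ∀ z, x < z → v z = z := fun z hz =>
        ih (e - 1) (by omega) (by omega) (by omega)
      have h1 : v x ≤ x := by
        by_contra hc
        have := v.injective (hfix (v x) (by omega))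
        omega
      obtain ⟨z, hz⟩ := v.surjective x
      rcases lt_trichotomy z x with h | rfl | h
      · have h2 := key x hx hxd
        have := hv.blockCols 0 z x ⟨by omega, by omega⟩ ⟨by omega, by omega⟩ h
        omega
      · exact hz
      · have := hfix z h
        omega

variable {m : ℕ}

/-- `v'` arises from `v` by enlarging all blocks by `m`: the `m` new rows of block row `j` are
mapped to the `m` new columns of block column `j + 1`, and `v'` agrees with `v` on the other
rows. -/
structure IsEnlargement (m : ℕ) (b : Fin (n + 1) → ℕ) (v v' : Equiv.Perm ℕ) : Prop where
  apply_new : ∀ (j : Fin n), ∀ t < m, v' (rowStart (fun j => m + b j) j.castSucc + t) =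
    colStart (fun j => m + b j) j.succ + t
  apply_rowShift : ∀ x, v' (rowShift m b x) = colShift m b (v x)

lemma isEnlargement_demazure {Ps : ∀ j : Fin n, PipeDream (b j.castSucc) (b j.succ)}
    {Ps' : ∀ j : Fin n, PipeDream (m + b j.castSucc) (m + b j.succ)}
    (hP : ∀ j, (Ps' j).demazure = shiftPerm m (Ps j).demazure) :
    IsEnlargement m b (assemble b Ps).demazure (assemble (fun j => m + b j) Ps').demazure := by
  refine ⟨fun j => (demazure_enlarge_castSucc hP j).1, fun x => ?_⟩
  rcases le_or_gt (rowStart b (Fin.last n)) x with hx | hx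
  · obtain ⟨y, rfl⟩ := Nat.exists_eq_add_of_le hx
    rw [rowShift_last, demazure_enlarge_last hP]
  · obtain ⟨j, hj⟩ := exists_inBlockRow b (x := x) (by rw [← rowStart_last]; omega)
    obtain ⟨j, rfl⟩ := (Fin.exists_castSucc_eq (i := j)).2 (by
      rintro rfl
      exact absurd hj.1 hx.not_ge)
    obtain ⟨t, rfl⟩ := Nat.exists_eq_add_of_le hj.1
    have ht : t < b j.castSucc := by
      have := hj.2
      omega
    rw [rowShift_castSucc m j ht, (demazure_enlarge_castSucc hP j).2 t ht]

variable (m b) in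
lemma exists_eq_rowShift (x : ℕ) :
    (∃ j : Fin n, ∃ t < m, x = rowStart (fun j => m + b j) j.castSucc + t) ∨
      ∃ y, x = rowShift m b y := by
  rcases le_or_gt (rowStart (fun j => m + b j) (Fin.last n)) x with hx | hx
  · obtain ⟨y, rfl⟩ := Nat.exists_eq_add_of_le hx
    exact Or.inr ⟨_, (rowShift_last m y).symm⟩
  · obtain ⟨j, hj⟩ := exists_inBlockRow (fun j => m + b j) (x := x)
      (by rw [← rowStart_last]; omega)
    obtain ⟨j, rfl⟩ := (Fin.exists_castSucc_eq (i := j)).2 (by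
      rintro rfl
      exact absurd hj.1 hx.not_ge)
    obtain ⟨t, rfl⟩ := Nat.exists_eq_add_of_le hj.1
    rcases lt_or_ge t m with ht | ht
    · exact Or.inl ⟨j, t, ht, rfl⟩
    · obtain ⟨t, rfl⟩ := Nat.exists_eq_add_of_le ht
      have ht : m + t < m + b j.castSucc := Nat.lt_of_add_lt_add_left hj.2
      exact Or.inr ⟨_, (rowShift_castSucc m j (by omega)).symm⟩

lemma rowShift_sum_add (t : ℕ) :
    rowShift m b (∑ j, b j + t) = ∑ j, b j + m * n + t := by
  rw [← rowStart_last, add_assoc, rowShift_last, rowStart_enlarge, Fin.val_last]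
  ring

lemma colShift_sum_add (t : ℕ) :
    colShift m b (∑ j, b j + t) = ∑ j, b j + m * n + t := by
  rw [← colStart_zero, add_assoc, colShift_zero, colStart_enlarge, Fin.val_zero, Nat.sub_zero]
  ring

lemma rowShift_lt_sum_iff {x : ℕ} :
    rowShift m b x < ∑ j, (m + b j) ↔ x < ∑ j, b j + m := by
  rw [sum_enlarge, ← rowShift_sum_add, (rowShift_strictMono m b).lt_iff_lt]

lemma colShift_lt_sum_iff {y : ℕ} :
    colShift m b y < ∑ j, (m + b j) ↔ y < ∑ j, b j + m := by
  rw [sum_enlarge, ← colShift_sum_add, (colShift_strictMono m b).lt_iff_lt]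

lemma inBlockRow_castSucc_rowShift_iff {j : Fin n} {x : ℕ} :
    InBlockRow (fun j => m + b j) j.castSucc (rowShift m b x) ↔ InBlockRow b j.castSucc x := by
  have h1 := rowStart_le_rowShift_iff (b := b) m j.castSucc x
  have h2 := rowStart_le_rowShift_iff (b := b) m j.succ x
  rw [rowStart_succ, rowStart_succ] at h2
  rw [InBlockRow, InBlockRow, h1, ← not_le, h2, not_le]

lemma inBlockCol_succ_colShift_iff {i : Fin n} {y : ℕ} :
    InBlockCol (fun j => m + b j) i.succ (colShift m b y) ↔ InBlockCol b i.succ y := by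
  have h1 := colStart_le_colShift_iff (b := b) m i.succ y
  have h2 := colStart_le_colShift_iff (b := b) m i.castSucc y
  rw [colStart_castSucc, colStart_castSucc] at h2
  rw [InBlockCol, InBlockCol, h1, ← not_le, h2, not_le]

lemma InBlockRow.rowShift {j : Fin (n + 1)} {x : ℕ} (h : InBlockRow b j x) :
    InBlockRow (fun j => m + b j) j (rowShift m b x) := by
  induction j using Fin.lastCases with
  | cast j => exact inBlockRow_castSucc_rowShift_iff.2 h
  | last =>
    refine ⟨(rowStart_le_rowShift_iff m _ _).2 h.1, ?_⟩
    rw [rowStart_last (fun j => m + b j), rowShift_lt_sum_iff]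
    have := h.lt_sum
    omega

lemma InBlockCol.colShift {i : Fin (n + 1)} {y : ℕ} (h : InBlockCol b i y) :
    InBlockCol (fun j => m + b j) i (colShift m b y) := by
  induction i using Fin.cases with
  | succ i => exact inBlockCol_succ_colShift_iff.2 h
  | zero =>
    refine ⟨(colStart_le_colShift_iff m _ _).2 h.1, ?_⟩
    rw [colStart_zero (fun j => m + b j), colShift_lt_sum_iff]
    have := h.lt_sum
    omega

lemma InBlockRow.of_rowShift {j : Fin (n + 1)} {x : ℕ}
    (h : InBlockRow (fun j => m + b j) j (LacingDiagrams.rowShift m b x)) :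
    InBlockRow b j x ∨ ∑ j, b j ≤ x := by
  induction j using Fin.lastCases with
  | cast j => exact Or.inl (inBlockRow_castSucc_rowShift_iff.1 h)
  | last =>
    refine (lt_or_ge x (∑ j, b j)).imp_left fun hx => ⟨(rowStart_le_rowShift_iff m _ _).1 h.1, ?_⟩
    rwa [rowStart_last]

lemma InBlockCol.of_colShift {i : Fin (n + 1)} {y : ℕ}
    (h : InBlockCol (fun j => m + b j) i (LacingDiagrams.colShift m b y)) :
    InBlockCol b i y ∨ ∑ j, b j ≤ y := by
  induction i using Fin.cases with
  | succ i => exact Or.inl (inBlockCol_succ_colShift_iff.1 h)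
  | zero =>
    refine (lt_or_ge y (∑ j, b j)).imp_left fun hy => ⟨(colStart_le_colShift_iff m _ _).1 h.1, ?_⟩
    rwa [colStart_zero]

lemma inBlockRow_new (j : Fin n) {t : ℕ} (ht : t < m) :
    InBlockRow (fun j => m + b j) j.castSucc (rowStart (fun j => m + b j) j.castSucc + t) :=
  ⟨Nat.le_add_right _ _, by beta_reduce; omega⟩

lemma inBlockCol_new (j : Fin n) {t : ℕ} (ht : t < m) :
    InBlockCol (fun j => m + b j) j.succ (colStart (fun j => m + b j) j.succ + t) :=
  ⟨Nat.le_add_right _ _, by beta_reduce; omega⟩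

variable {v v' : Equiv.Perm ℕ}

lemma IsEnlargement.southeastRank_eq (h : IsEnlargement m b v v')
    (hv : ∀ x, ∑ j, b j ≤ x → v x = x) {i j : Fin (n + 1)} (hij : i ≤ j) :
    southeastRank (fun j => m + b j) v' i j = m + southeastRank b v i j := by
  have hset : {x | rowStart (fun j => m + b j) j ≤ x ∧ x < ∑ j, (m + b j) ∧
      colStart (fun j => m + b j) i ≤ v' x ∧ v' x < ∑ j, (m + b j)} = rowShift m b ''
      (Set.Ico (∑ j, b j) (∑ j, b j + m) ∪
        {x | rowStart b j ≤ x ∧ x < ∑ j, b j ∧ colStart b i ≤ v x ∧ v x < ∑ j, b j}) := by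
    ext x'
    rcases exists_eq_rowShift b m x' with ⟨q, t, ht, rfl⟩ | ⟨x, rfl⟩
    · constructor
      · rintro ⟨h1, -, h3, -⟩
        -- The new entries lie outside of the region, since `i ≤ j`.
        rw [h.apply_new q t ht] at h3
        have h4 := (inBlockRow_new (b := b) q ht).le_iff.1 h1
        have h5 := (inBlockCol_new (b := b) q ht).le_iff.1 h3
        exact absurd (h5.trans (hij.trans h4)) (Fin.castSucc_lt_succ).not_ge
      · rintro ⟨x, hx, he⟩
        exfalso
        rcases le_or_gt (rowStart b q.castSucc) x with hq | hq
        · have := rowStart_add_le_rowShift m hq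
          omega
        · have := (not_congr (rowStart_le_rowShift_iff m q.castSucc x)).2 hq.not_ge
          omega
    · rw [(rowShift_strictMono m b).injective.mem_set_image]
      simp only [Set.mem_ofPred_eq, Set.mem_union, Set.mem_Ico, h.apply_rowShift,
        rowStart_le_rowShift_iff, colStart_le_colShift_iff, rowShift_lt_sum_iff,
        colShift_lt_sum_iff]
      have hr := rowStart_add_le_sum b j
      have hc := colStart_add_le_sum b i
      rcases lt_or_ge x (∑ j, b j) with hx | hx
      · have := lt_of_fixes hv hx
        constructor
        · rintro ⟨h1, -, h3, -⟩
          exact Or.inr ⟨h1, hx, h3, this⟩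
        · rintro (h1 | ⟨h1, -, h3, -⟩)
          · omega
          · exact ⟨h1, by omega, h3, by omega⟩
      · rw [hv x hx]
        constructor
        · rintro ⟨-, h2, -, -⟩
          exact Or.inl ⟨hx, h2⟩
        · rintro (h1 | ⟨-, h2, -, -⟩)
          · exact ⟨by omega, by omega, by omega, by omega⟩
          · omega
  rw [LacingDiagrams.southeastRank_eq, LacingDiagrams.southeastRank_eq, hset,
    Set.ncard_image_of_injective _ (rowShift_strictMono m b).injective,
    Set.ncard_union_eq ?_ (Set.finite_Ico _ _)
      ((Set.finite_Iio (∑ j, b j)).subset fun x hx => hx.2.1)]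
  · rw [← Finset.coe_Ico, Set.ncard_coe_finset, Nat.card_Ico, Nat.add_sub_cancel_left]
  · rw [Set.disjoint_left]
    rintro x ⟨h1, -⟩ ⟨-, h2, -⟩
    omega

lemma IsEnlargement.fixes_iff (h : IsEnlargement m b v v') :
    (∀ x, ∑ j, b j ≤ x → v x = x) ↔ ∀ x, ∑ j, b j + m * n ≤ x → v' x = x := by
  constructor
  · intro hv x hx
    obtain ⟨t, rfl⟩ := Nat.exists_eq_add_of_le hx
    rw [← rowShift_sum_add, h.apply_rowShift, hv _ (Nat.le_add_right _ _), colShift_sum_add,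
      rowShift_sum_add]
  · intro hv x hx
    obtain ⟨t, rfl⟩ := Nat.exists_eq_add_of_le hx
    apply (colShift_strictMono m b).injective
    rw [← h.apply_rowShift, rowShift_sum_add, colShift_sum_add, hv _ (Nat.le_add_right _ _)]

lemma IsEnlargement.isZelevinsky (h : IsEnlargement m b v v') (hv : IsZelevinsky b v) :
    IsZelevinsky (fun j => m + b j) v' where
  fixes x hx := h.fixes_iff.1 hv.fixes x (by rw [sum_enlarge] at hx; omega)
  zeroBlocks i j x' hj hi := by
    rcases exists_eq_rowShift b m x' with ⟨q, t, ht, rfl⟩ | ⟨x, rfl⟩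
    · rw [h.apply_new q t ht] at hi
      rw [hj.unique (inBlockRow_new q ht), hi.unique (inBlockCol_new q ht)]
      simp
    · rw [h.apply_rowShift] at hi
      rcases hj.of_rowShift with hj' | hx
      · rcases hi.of_colShift with hi' | hy
        · exact hv.zeroBlocks i j x hj' hi'
        · have := lt_of_fixes hv.fixes hj'.lt_sum
          omega
      · have h1 := hj.le_iff.1 ((rowStart_le_rowShift_iff (b := b) m (Fin.last n) x).2 (by
          have := rowStart_last b
          omega))
        have := Fin.le_def.1 h1
        have := i.2
        simp only [Fin.val_last] at *
        omega
  blockRows j x₁ x₂ h₁ h₂ hlt := by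
    rcases exists_eq_rowShift b m x₁ with ⟨q, t, ht, rfl⟩ | ⟨x, rfl⟩
    · obtain rfl := h₁.unique (inBlockRow_new q ht)
      rcases exists_eq_rowShift b m x₂ with ⟨q', t', ht', rfl⟩ | ⟨y, rfl⟩
      · obtain rfl := Fin.castSucc_injective _ (h₂.unique (inBlockRow_new q' ht'))
        rw [h.apply_new q t ht, h.apply_new q t' ht']
        omega
      · have hy := inBlockRow_castSucc_rowShift_iff.1 h₂
        rw [h.apply_new q t ht, h.apply_rowShift]
        obtain ⟨i, hi⟩ := exists_inBlockCol b (lt_of_fixes hv.fixes hy.lt_sum)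
        have hiq := hv.zeroBlocks i q.castSucc y hy hi
        have := colStart_add_le_colShift m (j := q) (hi.le_iff.2 (by
          rw [Fin.le_def]
          simp only [Fin.val_castSucc] at hiq
          simp only [Fin.val_succ]
          omega))
        omega
    · rcases exists_eq_rowShift b m x₂ with ⟨q, t, ht, rfl⟩ | ⟨y, rfl⟩
      · obtain rfl := h₂.unique (inBlockRow_new q ht)
        have := rowStart_add_le_rowShift m (inBlockRow_castSucc_rowShift_iff.1 h₁).1
        omega
      · rw [(rowShift_strictMono m b).lt_iff_lt] at hlt
        rw [h.apply_rowShift, h.apply_rowShift, (colShift_strictMono m b).lt_iff_lt]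
        rcases h₂.of_rowShift with hy | hy
        · rcases h₁.of_rowShift with hx | hx
          · exact hv.blockRows j x y hx hy hlt
          · have := hy.lt_sum
            omega
        · rw [hv.fixes y hy]
          rcases lt_or_ge x (∑ j, b j) with hx | hx
          · have := lt_of_fixes hv.fixes hx
            omega
          · rwa [hv.fixes x hx]
  blockCols i x₁ x₂ h₁ h₂ hlt := by
    rcases exists_eq_rowShift b m x₁ with ⟨q, t, ht, rfl⟩ | ⟨x, rfl⟩
    · rw [h.apply_new q t ht] at h₁ ⊢
      obtain rfl := h₁.unique (inBlockCol_new q ht)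
      rcases exists_eq_rowShift b m x₂ with ⟨q', t', ht', rfl⟩ | ⟨y, rfl⟩
      · rw [h.apply_new q' t' ht'] at h₂ ⊢
        obtain rfl := Fin.succ_injective _ (h₂.unique (inBlockCol_new q' ht'))
        omega
      · rw [h.apply_rowShift] at h₂ ⊢
        have := colStart_add_le_colShift m (inBlockCol_succ_colShift_iff.1 h₂).1
        omega
    · rw [h.apply_rowShift] at h₁ ⊢
      rcases exists_eq_rowShift b m x₂ with ⟨q, t, ht, rfl⟩ | ⟨y, rfl⟩
      · rw [h.apply_new q t ht] at h₂
        obtain rfl := h₂.unique (inBlockCol_new q ht)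
        -- The entry of `v` in row `x` would lie in one of the zero blocks.
        have hx : x < rowStart b q.castSucc := by
          by_contra hc
          have := rowStart_add_le_rowShift m (not_lt.1 hc)
          omega
        have hcol := inBlockCol_succ_colShift_iff.1 h₁
        have hle := rowStart_add_le_sum b q.castSucc
        obtain ⟨p, hp⟩ := exists_inBlockRow b (x := x) (by omega)
        have hpq := (not_congr (hp.le_iff (j := q.castSucc))).1 hx.not_ge
        rw [not_le, Fin.lt_def, Fin.val_castSucc] at hpq
        refine absurd ?_ (hv.zeroBlocks _ _ x hp hcol)
        rw [Fin.val_succ]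
        omega
      · rw [h.apply_rowShift] at h₂ ⊢
        rw [(rowShift_strictMono m b).lt_iff_lt] at hlt
        rw [(colShift_strictMono m b).lt_iff_lt]
        rcases lt_or_ge y (∑ j, b j) with hy | hy
        · have h1 := lt_of_fixes hv.fixes hy
          have h2 := lt_of_fixes hv.fixes (hlt.trans hy)
          exact hv.blockCols i x y (h₁.of_colShift.resolve_right h2.not_ge)
            (h₂.of_colShift.resolve_right h1.not_ge) hlt
        · rw [hv.fixes y hy]
          rcases lt_or_ge x (∑ j, b j) with hx | hx
          · have := lt_of_fixes hv.fixes hx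
            omega
          · rwa [hv.fixes x hx]

lemma IsEnlargement.isZelevinsky_of_enlarge (h : IsEnlargement m b v v')
    (hv' : IsZelevinsky (fun j => m + b j) v') (hfix : ∀ x, ∑ j, b j ≤ x → v x = x) :
    IsZelevinsky b v where
  fixes := hfix
  zeroBlocks i j x hj hi :=
    hv'.zeroBlocks i j _ hj.rowShift (by rw [h.apply_rowShift]; exact hi.colShift)
  blockRows j x y hx hy hlt := by
    have := hv'.blockRows j _ _ hx.rowShift hy.rowShift ((rowShift_strictMono m b) hlt)
    rwa [h.apply_rowShift, h.apply_rowShift, (colShift_strictMono m b).lt_iff_lt] at this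
  blockCols i x y hx hy hlt := by
    have := hv'.blockCols i _ _ (by rw [h.apply_rowShift]; exact hx.colShift)
      (by rw [h.apply_rowShift]; exact hy.colShift) ((rowShift_strictMono m b) hlt)
    rwa [h.apply_rowShift, h.apply_rowShift, (colShift_strictMono m b).lt_iff_lt] at this

end Blocks

section Arrays

variable {n m : ℕ} {r : TriArray n}

lemma IsZelevinskyOf.fixes_of_shift {v' : Equiv.Perm ℕ}
    (hv' : IsZelevinskyOf (r.shift m) v') {x : ℕ} (hx : ∑ j, r.ranks j + m * n ≤ x) :
    v' x = x := by
  refine hv'.1.fixes_of_le ?_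
  rw [hv'.2 0 (Fin.last n) (Fin.zero_le _)]
  have h := sum_enlarge m r.ranks
  change ∑ j, (m + r.ranks j) ≤ x + (m + r _)
  omega

theorem IsEnlargement.isZelevinskyOf_iff {v v' : Equiv.Perm ℕ}
    (h : IsEnlargement m r.ranks v v') :
    IsZelevinskyOf (r.shift m) v' ↔ IsZelevinskyOf r v := by
  constructor
  · intro hv'
    have hfix := h.fixes_iff.2 fun x hx => hv'.fixes_of_shift hx
    refine ⟨h.isZelevinsky_of_enlarge hv'.1 hfix, fun i j hij => ?_⟩
    have := (h.southeastRank_eq hfix hij).symm.trans (hv'.2 i j hij)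
    exact Nat.add_left_cancel this
  · intro hv
    refine ⟨h.isZelevinsky hv.1, fun i j hij => ?_⟩
    refine (h.southeastRank_eq hv.1.fixes hij).trans ?_
    rw [hv.2 i j hij]

/-! ### Lacing diagrams -/

/-- The rotation of a pipe dream takes the reverse complement of its word, and `1_m ⊕ ·` is
compatible with reverse complements. -/
lemma demazure_eq_of_rotate {k l : ℕ} {P : PipeDream k l} {P' : PipeDream (m + k) (m + l)}
    (h : P'.rotate.demazure = shiftPerm m P.rotate.demazure) :
    P'.demazure = shiftPerm m P.demazure := by
  have hword : sortWord id P'.rotate.word = sortWord id (P.rotate.word.map (m + ·)) := by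
    rw [sortWord_id_map_add, ← PipeDream.coe_demazure, h, coe_shiftPerm, PipeDream.coe_demazure]
  have hmap : reverseComplement (m + k + (m + l)) (P.rotate.word.map (m + ·)) =
      (reverseComplement (k + l) P.rotate.word).map (m + ·) := by
    rw [reverseComplement, reverseComplement, List.map_reverse, List.map_map, List.map_map]
    congr 1
    refine List.map_congr_left fun i hi => ?_
    have := P.rotate.add_two_le_of_mem_word hi
    simp only [Function.comp_apply]
    omega
  have key := sortWord_reverseComplement_congr (N := m + k + (m + l))
    (fun i hi => P'.rotate.add_two_le_of_mem_word hi) (fun i hi => by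
      obtain ⟨j, hj, rfl⟩ := List.mem_map.1 hi
      have := P.rotate.add_two_le_of_mem_word hj
      omega) hword
  rw [hmap, ← PipeDream.word_rotate, ← PipeDream.word_rotate, PipeDream.rotate_rotate,
    PipeDream.rotate_rotate, sortWord_id_map_add] at key
  refine Equiv.coe_fn_injective ?_
  beta_reduce
  rw [PipeDream.coe_demazure, key, coe_shiftPerm, PipeDream.coe_demazure]

theorem shift_mem_L_iff {w : LacingDiagram r.ranks} :
    (LacingDiagram.shift m w : LacingDiagram (r.shift m).ranks) ∈ L (r.shift m) ↔ w ∈ L r := by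
  constructor
  · rintro ⟨Ps', hPs', hZ⟩
    have hex : ∀ j, ∃ P : PipeDream (r.ranks j.castSucc) (r.ranks j.succ),
        IsMinimalCompletion (w j) P.rotate.demazure ∧
          (Ps' j).rotate.demazure = shiftPerm m P.rotate.demazure := by
      intro j
      have hmin : IsMinimalCompletion (shiftPartialPerm m (w j)) (Ps' j).rotate.demazure := hPs' j
      obtain ⟨g, hg⟩ := exists_eq_shiftPerm (m := m) (u := (Ps' j).rotate.demazure)
        hmin.1.apply_of_lt
      rw [hg, isMinimalCompletion_shift_iff] at hmin
      obtain ⟨P, hP⟩ := hmin.exists_demazure_eq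
      refine ⟨P.rotate, ?_, ?_⟩
      · rwa [PipeDream.rotate_rotate, hP]
      · rw [PipeDream.rotate_rotate, hP, hg]
    choose Ps hPs hrot using hex
    exact ⟨Ps, hPs, (isEnlargement_demazure fun j =>
      demazure_eq_of_rotate (hrot j)).isZelevinskyOf_iff.1 hZ⟩
  · rintro ⟨Ps, hPs, hZ⟩
    have hex : ∀ j, ∃ P : PipeDream (m + r.ranks j.castSucc) (m + r.ranks j.succ),
        IsMinimalCompletion (shiftPartialPerm m (w j)) P.rotate.demazure ∧
          P.rotate.demazure = shiftPerm m (Ps j).rotate.demazure := by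
      intro j
      have hmin := isMinimalCompletion_shift_iff (m := m).2 (hPs j)
      obtain ⟨P, hP⟩ := hmin.exists_demazure_eq
      refine ⟨P.rotate, ?_, ?_⟩
      · rwa [PipeDream.rotate_rotate, hP]
      · rw [PipeDream.rotate_rotate, hP]
    choose Ps' hPs' hrot using hex
    exact ⟨Ps', hPs', (isEnlargement_demazure fun j =>
      demazure_eq_of_rotate (hrot j)).isZelevinskyOf_iff.2 hZ⟩

/-- Every lacing diagram with Demazure product `m + r` is of the form `m + w`. -/
theorem exists_eq_shift_of_mem_L {u : LacingDiagram (r.shift m).ranks} (hu : u ∈ L (r.shift m)) :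
    ∃ w : LacingDiagram r.ranks, u = LacingDiagram.shift m w := by
  obtain ⟨Ps, hPs, hZ⟩ := hu
  have hletter : ∀ i ∈ (assemble (r.shift m).ranks Ps).word, i + 1 < ∑ j, r.ranks j + m * n := by
    intro i hi
    refine letters_lt_of_fixes (fun x hx => ?_) hi
    rw [← PipeDream.coe_demazure]
    exact hZ.fixes_of_shift hx
  have hex : ∀ j : Fin n, ∃ w : PartialPerm (r.ranks j.castSucc) (r.ranks j.succ),
      u j = shiftPartialPerm m w := by
    intro j
    -- A cross `(p, q)` of `P_{j+1}` has the letter `D - (r_j + m) - (r_{j+1} + m) + p + q` in the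
    -- assembled word, where `D` is the size of the enlarged grid.
    have hsum : rowStart (r.shift m).ranks j.castSucc + (m + r.ranks j.castSucc) +
        (m + r.ranks j.succ) + colStart (r.shift m).ranks j.succ =
        ∑ j, r.ranks j + m * n + m := by
      rw [← sum_enlarge, ← rowStart_add_colStart (fun j => m + r.ranks j) j.succ, rowStart_succ]
    have hge : ∀ i ∈ (Ps j).rotate.word, m ≤ i := by
      intro i hi
      obtain ⟨p, q, hpq, rfl⟩ := (Ps j).rotate.mem_word.1 hi
      have hpq' : (p.rev, q.rev) ∈ Ps j := by
        simpa [PipeDream.rotate] using hpq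
      have hp : (p.rev : ℕ) + p + 1 = m + r.ranks j.castSucc := by
        have := p.2
        rw [Fin.val_rev]
        change (p : ℕ) < m + r.ranks j.castSucc at this
        change m + r.ranks j.castSucc - (p + 1) + p + 1 = _
        omega
      have hq : (q.rev : ℕ) + q + 1 = m + r.ranks j.succ := by
        have := q.2
        rw [Fin.val_rev]
        change (q : ℕ) < m + r.ranks j.succ at this
        change m + r.ranks j.succ - (q + 1) + q + 1 = _
        omega
      have h1 := rowStart_add_le_sum (r.shift m).ranks j.castSucc
      have h2 := colStart_add_le_sum (r.shift m).ranks j.succ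
      have h3 := hletter _ ((PipeDream.mem_word _).2
        ⟨⟨rowStart (r.shift m).ranks j.castSucc + p.rev, by have := p.rev.2; omega⟩,
          ⟨colStart (r.shift m).ranks j.succ + q.rev, by have := q.rev.2; omega⟩,
          mem_assemble.2 (Or.inr ⟨j, p.rev, q.rev, hpq', rfl, rfl⟩), rfl⟩)
      simp only at h3
      omega
    have hmin : IsMinimalCompletion (u j) (Ps j).rotate.demazure := hPs j
    obtain ⟨g, hg⟩ := exists_eq_shiftPerm (m := m) (u := (Ps j).rotate.demazure) fun x hx => by
      rw [PipeDream.coe_demazure, sortWord_apply_of_forall_ne]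
      · rfl
      · intro i hi
        have := hge i hi
        omega
    have hg1 := hmin.1
    rw [hg] at hg1
    exact ⟨corner _ _ g, hg1.eq (completes_shift_iff.2
      (completes_corner (finitelySupported_shiftPerm_iff.1 hg1.1)))⟩
  choose w hw using hex
  exact ⟨w, funext hw⟩

lemma lacingDiagram_shift_injective {b : Fin (n + 1) → ℕ} :
    Function.Injective (LacingDiagram.shift m : LacingDiagram b → _) := fun _ _ h =>
  funext fun j => shiftPartialPerm_injective (congrFun h j)

end Arrays

end LacingDiagrams

theorem proposition4p4 (n : ℕ) (r : LacingDiagrams.TriArray n) (m : ℕ) :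
    LacingDiagrams.L (LacingDiagrams.TriArray.shift m r) =
        {u | ∃ w ∈ LacingDiagrams.L r, u = LacingDiagrams.LacingDiagram.shift m w} ∧
      Set.BijOn (fun w : LacingDiagrams.LacingDiagram r.ranks =>
          (LacingDiagrams.LacingDiagram.shift m w :
            LacingDiagrams.LacingDiagram (LacingDiagrams.TriArray.shift m r).ranks))
        (LacingDiagrams.L r) (LacingDiagrams.L (LacingDiagrams.TriArray.shift m r)) := by
  refine ⟨?_, fun w hw => LacingDiagrams.shift_mem_L_iff.2 hw,
    LacingDiagrams.lacingDiagram_shift_injective.injOn, ?_⟩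
  · ext u
    constructor
    · intro hu
      obtain ⟨w, rfl⟩ := LacingDiagrams.exists_eq_shift_of_mem_L hu
      exact ⟨w, LacingDiagrams.shift_mem_L_iff.1 hu, rfl⟩
    · rintro ⟨w, hw, rfl⟩
      exact LacingDiagrams.shift_mem_L_iff.2 hw
  · intro u hu
    obtain ⟨w, rfl⟩ := LacingDiagrams.exists_eq_shift_of_mem_L hu
    exact ⟨w, LacingDiagrams.shift_mem_L_iff.1 hu, rfl⟩
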